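/- Let $N\ge 1$. For $p\ge 1$ and $z\in\mathbb C^k$ put $|z|_p:=\big(|\Re z|^p+|\Im z|^p\big)^{1/p}$, where $\Re z,\Im z\in\mathbb R^k$ are taken coordinatewise and $|\cdot|$ is the Euclidean norm (used for $k=1$ and $k=N$), and let $$Q_{p,N}:=\frac1p\int_{\mathbb S^{N-1}}|\boldsymbol\omega\cdot h|^p\,d\mathcal H^{N-1}(h),$$ where $\boldsymbol\omega\in\mathbb R^N$ is an arbitrary unit vector and $\mathcal H^{N-1}$ is the surface measure on the unit sphere. Let $\Omega\subset\mathbb R^N$ be an open bounded set with Lipschitz boundary (near each boundary point, in suitable orthonormal coordinates, $\Omega$ is the strict epigraph of a Lipschitz function of $N-1$ variables). Let $A\in C^2(\mathbb R^N,\mathbb R^N)$ and $p\ge 1$. Let $u\in W^{1,p}_A(\Omega)$, that is, $u\in L^p(\Omega,\mathbb C)$ has a weak gradient $\nabla u\in L^1_{\mathrm{loc}}(\Omega,\mathbb C^N)$ with $\int_\Omega|\nabla u-\mathrm iAu|_p^p\,dx<\infty$. Let $\{\rho_m\}_{m\in\mathbb N}$ be a sequence of non-negative measurable radial functions on $\mathbb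 R^N$, $\rho_m(x)=\rho_m(|x|)$, such that $$\lim_{m\to\infty}\int_0^\infty\rho_m(r)\,r^{N-1}\,dr=1\qquad\text{and}\qquad \lim_{m\to\infty}\int_\delta^\infty\rho_m(r)\,r^{N-1}\,dr=0\quad\text{for every }\delta>0.$$ Then $$\lim_{m\to\infty}\int_\Omega\int_\Omega\frac{\big|u(x)-e^{\mathrm i(x-y)\cdot A\left(\frac{x+y}2\right)}u(y)\big|_p^p}{|x-y|^p}\,\rho_m(x-y)\,dx\,dy=p\,Q_{p,N}\int_\Omega|\nabla u-\mathrm iAu|_p^p\,dx .$$ -/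

import Mathlib

open MeasureTheory Filter Topology
open scoped ENNReal NNReal

noncomputable section

/-- `ℝ^N` with its Euclidean norm. -/
abbrev RN (N : ℕ) : Type := EuclideanSpace ℝ (Fin N)

/-- `ℂ^N`. -/
abbrev CN (N : ℕ) : Type := EuclideanSpace ℂ (Fin N)

/-- The norm `|z|_p = (|Re z|^p + |Im z|^p)^(1/p)` on `ℂ^N`, where `Re z` and `Im z` are taken
coordinatewise and measured in the Euclidean norm of `ℝ^N`. -/
def pNormVec {N : ℕ} (p : ℝ) (z : CN N) : ℝ :=
  (‖(WithLp.toLp 2 (fun j => (z j).re) : RN N)‖ ^ p +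
    ‖(WithLp.toLp 2 (fun j => (z j).im) : RN N)‖ ^ p) ^ (1 / p)

/-- The norm `|a|_p = (|Re a|^p + |Im a|^p)^(1/p)` on `ℂ` (the case `N = 1` of `pNormVec`). -/
def pNorm (p : ℝ) (a : ℂ) : ℝ :=
  (|a.re| ^ p + |a.im| ^ p) ^ (1 / p)

/-- `Ω` has Lipschitz boundary: near each boundary point, and in suitable orthonormal coordinates
with last axis `e`, the set `Ω` is the strict epigraph of a Lipschitz function of the other
coordinates; `y - ⟪e, y⟫ e` is the orthogonal projection of `y` to the hyperplane `e^⊥`. -/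
def HasLipschitzBoundary {N : ℕ} (Ω : Set (RN N)) : Prop :=
  ∀ x ∈ frontier Ω, ∃ r : ℝ, 0 < r ∧ ∃ e : RN N, ‖e‖ = 1 ∧
    ∃ (L : ℝ≥0) (γ : RN N → ℝ), LipschitzWith L γ ∧
      ∀ y ∈ Metric.ball x r, (y ∈ Ω ↔ γ (y - inner ℝ e y • e) < inner ℝ e y)

/-- `G` is the weak (distributional) gradient of `u` on the open set `Ω`: both are locally
integrable on `Ω`, and `∫_Ω u ∂_j φ = - ∫_Ω G_j φ` for each `j` and each `φ ∈ C_c^∞(Ω)`. -/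
structure IsWeakGradient {N : ℕ} (Ω : Set (RN N)) (u : RN N → ℂ) (G : RN N → CN N) : Prop where
  locallyIntegrableOn_fun : LocallyIntegrableOn u Ω
  locallyIntegrableOn_grad : LocallyIntegrableOn G Ω
  integral_eq : ∀ φ : RN N → ℝ, ContDiff ℝ (⊤ : ℕ∞) φ → HasCompactSupport φ → tsupport φ ⊆ Ω →
    ∀ j : Fin N,
      ∫ x in Ω, ((fderiv ℝ φ x (EuclideanSpace.single j 1) : ℝ) : ℂ) * u x =
        -∫ x in Ω, ((φ x : ℝ) : ℂ) * G x j

/-- The magnetic gradient `∇u - i A u` at `x`, where `G = ∇u`. -/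
def magneticGradient {N : ℕ} (A : RN N → RN N) (u : RN N → ℂ) (G : RN N → CN N) (x : RN N) :
    CN N :=
  WithLp.toLp 2 (fun j => G x j - Complex.I * ((A x j : ℝ) : ℂ) * u x)

/-- The magnetic energy `∫_Ω |∇u - i A u|_p^p dx ∈ [0, ∞]`, where `G = ∇u`. -/
def magneticEnergy {N : ℕ} (Ω : Set (RN N)) (A : RN N → RN N) (p : ℝ) (u : RN N → ℂ)
    (G : RN N → CN N) : ℝ≥0∞ :=
  ∫⁻ x in Ω, ENNReal.ofReal (pNormVec p (magneticGradient A u G x) ^ p)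

/-- `u ∈ W^{1,p}_A(Ω)`: `u ∈ L^p(Ω, ℂ)`, and `u` has a weak gradient with
`∫_Ω |∇u - i A u|_p^p dx < ∞`. -/
def MemMagneticSobolev {N : ℕ} (Ω : Set (RN N)) (A : RN N → RN N) (p : ℝ) (u : RN N → ℂ) : Prop :=
  MemLp u (ENNReal.ofReal p) (volume.restrict Ω) ∧
    ∃ G : RN N → CN N, IsWeakGradient Ω u G ∧ magneticEnergy Ω A p u G < ∞

/-- The constant `Q_{p,N} = (1/p) ∫_{S^{N-1}} |ω · h|^p dH^{N-1}(h)`, for a unit vector `ω`.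
The measure `volume.toSphere` is the surface measure of the unit sphere, normalized by the
polar coordinates formula `dx = r^(N-1) dr dH^{N-1}` (for `N = 1`, counting measure on two
points). -/
def sphereConst {N : ℕ} (p : ℝ) (ω : RN N) : ℝ :=
  1 / p * ∫ h : Metric.sphere (0 : RN N) 1, |inner ℝ ω (h : RN N)| ^ p
    ∂(volume : Measure (RN N)).toSphere

/-- The profiles `ρ_m : (0, ∞) → [0, ∞)` of a sequence of non-negative radial functions
`x ↦ ρ_m(|x|)` on `ℝ^N`, with `∫_0^∞ ρ_m(r) r^(N-1) dr → 1` and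
`∫_δ^∞ ρ_m(r) r^(N-1) dr → 0` for each `δ > 0`. -/
structure IsRadialMollifierSeq (N : ℕ) (ρ : ℕ → ℝ → ℝ) : Prop where
  aemeasurable : ∀ m, AEMeasurable (ρ m) (volume.restrict (Set.Ioi 0))
  nonneg : ∀ m, ∀ r, 0 < r → 0 ≤ ρ m r
  tendsto_one : Tendsto
    (fun m => ∫⁻ r in Set.Ioi (0 : ℝ), ENNReal.ofReal (ρ m r * r ^ (N - 1))) atTop (𝓝 1)
  tendsto_zero : ∀ δ : ℝ, 0 < δ → Tendsto
    (fun m => ∫⁻ r in Set.Ioi δ, ENNReal.ofReal (ρ m r * r ^ (N - 1))) atTop (𝓝 0)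

/-- The magnetic difference `u(x) - e^{i (x - y) · A((x + y)/2)} u(y)`. -/
def magneticDiff {N : ℕ} (A : RN N → RN N) (u : RN N → ℂ) (x y : RN N) : ℂ :=
  u x - Complex.exp (Complex.I * ((inner ℝ (x - y) (A ((1 / 2 : ℝ) • (x + y))) : ℝ) : ℂ)) * u y

/-- `∫_Ω ∫_Ω |u(x) - e^{i (x - y) · A((x + y)/2)} u(y)|_p^p / |x - y|^p ρ(|x - y|) dx dy`,
as an element of `[0, ∞]`. -/
def nonlocalEnergy {N : ℕ} (Ω : Set (RN N)) (A : RN N → RN N) (p : ℝ) (u : RN N → ℂ)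
    (ρ : ℝ → ℝ) : ℝ≥0∞ :=
  ∫⁻ y in Ω, ∫⁻ x in Ω,
    ENNReal.ofReal (pNorm p (magneticDiff A u x y) ^ p / ‖x - y‖ ^ p * ρ ‖x - y‖)

end

/-! Put `x = y + h` and use polar coordinates `h = r w`: the nonlocal energy becomes `∫₀^∞ ρ_m(r)
r^(N-1) Ψ(r) dr`, where `Ψ(r)` integrates over the sphere the `p`-energy of the magnetic difference
quotient of increment `r w` on `Ω ∩ (Ω - r w)` (`nonlocalEnergy_eq_lintegral_Ioi`). The weights
concentrate at `0`, so it suffices that `Ψ` has the right limit at `0+` and is bounded on each `(δ,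
∞)` (`tendsto_lintegral_mul_of_concentrating`).

The limit rests on a first-order Taylor estimate: `u(x+h) - u(x) - h·∇u(x)` has `L^p` norm `o(|h|)`
on `Ω ∩ (Ω - h)`, uniformly in the direction of `h` (`IsWeakGradient.exists_forall_eLpNorm_sub_le`).
It is proved without extending `u` as a Sobolev function across the boundary. Along segments inside
`Ω` the remainder is an average of `h·(∇u(x+th) - ∇u(x))`, small by continuity of translations in
`L^p`. Near the boundary the segment from `x` to `x+h` may leave `Ω`; it is replaced by a detour of
length comparable to `|h|`: up along the epigraph axis, across by `h`, and down again.

Expanding the phase adds `-i h·A(x) u(x)` to the linear term, up to `o(|h|)`. Difference quotients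
therefore converge in `L^p` to `w·(∇u - iAu)` for each direction `w`. Since `w` is real, real and
imaginary parts separate; averaging `|V·w|^p` over the sphere gives `p Q_{p,N} |V|^p` by rotation
invariance, and summing the two parts produces `|·|_p^p`. -/

/-! ### Polar coordinates and concentrating radial weights -/

theorem lintegral_eq_lintegral_Ioi_sphere {N : ℕ} (hN : 1 ≤ N) (f : RN N → ℝ≥0∞)
    (hf : AEMeasurable f) :
    ∫⁻ x, f x = ∫⁻ r in Set.Ioi (0 : ℝ), ENNReal.ofReal (r ^ (N - 1)) *
      ∫⁻ w : Metric.sphere (0 : RN N) 1, f (r • (w : RN N))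
        ∂(volume : Measure (RN N)).toSphere := by
  have : NeZero N := ⟨by omega⟩
  have hmp := (volume : Measure (RN N)).measurePreserving_homeomorphUnitSphereProd
  rw [show Module.finrank ℝ (RN N) = N by simp] at hmp
  have hs : (MeasurableSet ({0}ᶜ : Set (RN N))) := (measurableSet_singleton _).compl
  have hf' : AEMeasurable (fun x : ({0}ᶜ : Set (RN N)) => f x)
      (Measure.comap Subtype.val (volume : Measure (RN N))) :=
    hf.comp_quasiMeasurePreserving
      ⟨measurable_subtype_coe, by
        rw [(MeasurableEmbedding.subtype_coe hs).map_comap]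
        exact Measure.restrict_le_self.absolutelyContinuous⟩
  have hsymm := hmp.symm (Homeomorph.toMeasurableEquiv (homeomorphUnitSphereProd (RN N)))
  calc ∫⁻ x, f x = ∫⁻ x in ({0}ᶜ : Set (RN N)), f x := by
        rw [restrict_compl_singleton]
    _ = ∫⁻ x : ({0}ᶜ : Set (RN N)), f x ∂(Measure.comap Subtype.val volume) :=
        (lintegral_subtype_comap hs f).symm
    _ = ∫⁻ q : (Metric.sphere (0 : RN N) 1) × Set.Ioi (0 : ℝ), f (q.2.1 • (q.1 : RN N))
          ∂((volume : Measure (RN N)).toSphere.prod (Measure.volumeIoiPow (N - 1))) := by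
        rw [← hsymm.lintegral_comp_emb (MeasurableEquiv.measurableEmbedding _)]
        rfl
    _ = ∫⁻ r : Set.Ioi (0 : ℝ), ∫⁻ w : Metric.sphere (0 : RN N) 1, f (r.1 • (w : RN N))
          ∂(volume : Measure (RN N)).toSphere ∂(Measure.volumeIoiPow (N - 1)) := by
        rw [lintegral_prod_symm]
        exact hf'.comp_quasiMeasurePreserving hsymm.quasiMeasurePreserving
    _ = _ := by
        rw [Measure.volumeIoiPow, lintegral_withDensity_eq_lintegral_mul_non_measurable]
        · exact lintegral_subtype_comap measurableSet_Ioi (fun r => ENNReal.ofReal (r ^ (N - 1)) *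
            ∫⁻ w : Metric.sphere (0 : RN N) 1, f (r • (w : RN N))
              ∂(volume : Measure (RN N)).toSphere)
        · fun_prop
        · exact ae_of_all _ fun _ => ENNReal.ofReal_lt_top

/-- The profiles are only a.e. measurable in `r`; this makes `ρ(|h|)` a.e. measurable in `h`. Polar
coordinates show that a null set of radii has null preimage under the norm. -/
theorem ae_norm_of_ae_Ioi {N : ℕ} (hN : 1 ≤ N) {P : ℝ → Prop}
    (h : ∀ᵐ r ∂(volume.restrict (Set.Ioi (0 : ℝ))), P r) : ∀ᵐ x : RN N, P ‖x‖ := by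
  have : NeZero N := ⟨by omega⟩
  obtain ⟨s, hs, hsm, hs0⟩ := exists_measurable_superset_of_null (ae_iff.1 h)
  have hsP : ∀ r, ¬ P r → r ∈ s := fun r hr => hs hr
  have h1 : ∫⁻ x : RN N, (s.indicator 1 ‖x‖ : ℝ≥0∞) = 0 := by
    have hm : Measurable (fun x : RN N => (s.indicator 1 ‖x‖ : ℝ≥0∞)) :=
      (measurable_one.indicator hsm).comp measurable_norm
    rw [lintegral_eq_lintegral_Ioi_sphere hN _ hm.aemeasurable]
    rw [← lintegral_zero (μ := volume.restrict (Set.Ioi (0 : ℝ)))]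
    refine lintegral_congr_ae ?_
    filter_upwards [ae_restrict_mem measurableSet_Ioi, measure_eq_zero_iff_ae_notMem.1 hs0]
      with r hr hrs
    have hr' : (0 : ℝ) < r := hr
    simp [norm_smul, abs_of_pos hr', hrs]
  have h2 := (lintegral_eq_zero_iff ((measurable_one.indicator hsm).comp measurable_norm)).1 h1
  filter_upwards [h2] with x hx
  by_contra hP
  have := hsP _ hP
  simp [this] at hx

/-- Cut at a small `δ`: on `(0, δ]` the values of `Ψ` are close to `c` and the mass tends to `1`,
while beyond `δ` a bounded function meets vanishing mass. Only finite constants are pulled out of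
integrals, so neither `w` nor `Ψ` has to be measurable. -/
theorem tendsto_lintegral_mul_of_concentrating {w : ℕ → ℝ → ℝ≥0∞}
    (h1 : Tendsto (fun m => ∫⁻ r in Set.Ioi (0 : ℝ), w m r) atTop (𝓝 1))
    (h0 : ∀ δ : ℝ, 0 < δ → Tendsto (fun m => ∫⁻ r in Set.Ioi δ, w m r) atTop (𝓝 0))
    {Ψ : ℝ → ℝ≥0∞} {c : ℝ≥0∞} (hc : Tendsto Ψ (𝓝[>] 0) (𝓝 c))
    (hb : ∀ δ : ℝ, 0 < δ → ∃ C : ℝ≥0∞, C ≠ ∞ ∧ ∀ r, δ < r → Ψ r ≤ C) :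
    Tendsto (fun m => ∫⁻ r in Set.Ioi (0 : ℝ), w m r * Ψ r) atTop (𝓝 c) := by
  have hsplit : ∀ δ : ℝ, 0 < δ → ∀ f : ℝ → ℝ≥0∞, ∫⁻ r in Set.Ioi (0 : ℝ), f r =
      (∫⁻ r in Set.Ioc 0 δ, f r) + ∫⁻ r in Set.Ioi δ, f r := fun δ hδ f => by
    rw [← Set.Ioc_union_Ioi_eq_Ioi hδ.le, lintegral_union measurableSet_Ioi]
    exact Set.Ioc_disjoint_Ioi le_rfl
  refine tendsto_order.2 ⟨fun a ha => ?_, fun b hb' => ?_⟩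
  · obtain ⟨a', haa', ha'c⟩ := exists_between ha
    have ha't : a' ≠ ∞ := ha'c.ne_top
    obtain ⟨δ, hδ, hδΨ⟩ := mem_nhdsGT_iff_exists_Ioc_subset.1 (hc.eventually (lt_mem_nhds ha'c))
    have hδ0 : (0 : ℝ) < δ := hδ
    -- The mass of `(0, δ]` is written as total minus tail; `a'` is finite even if `c = ∞`, which
    -- makes truncated subtraction continuous here.
    have hlim : Tendsto (fun m => a' * (∫⁻ r in Set.Ioi (0 : ℝ), w m r) -
        a' * ∫⁻ r in Set.Ioi δ, w m r) atTop (𝓝 (a' * 1 - a' * 0)) :=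
      ENNReal.Tendsto.sub (ENNReal.Tendsto.const_mul h1 (Or.inr ha't))
        (ENNReal.Tendsto.const_mul (h0 δ hδ0) (Or.inr ha't)) (Or.inl (by simpa using ha't))
    simp only [mul_one, mul_zero, tsub_zero] at hlim
    filter_upwards [hlim.eventually (lt_mem_nhds haa')] with m hm
    refine hm.trans_le (tsub_le_iff_right.2 ?_)
    rw [hsplit δ hδ0 (w m), hsplit δ hδ0 (fun r => w m r * Ψ r), mul_add]
    gcongr ?_ + _
    refine le_trans ?_ (le_self_add)
    rw [← lintegral_const_mul' _ _ ha't]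
    refine setLIntegral_mono' measurableSet_Ioc fun r hr => ?_
    rw [mul_comm]
    gcongr
    exact (hδΨ hr).le
  · obtain ⟨b', hcb', hb'b⟩ := exists_between hb'
    have hb't : b' ≠ ∞ := hb'b.ne_top
    obtain ⟨δ, hδ, hδΨ⟩ := mem_nhdsGT_iff_exists_Ioc_subset.1 (hc.eventually (gt_mem_nhds hcb'))
    have hδ0 : (0 : ℝ) < δ := hδ
    obtain ⟨C, hC, hCΨ⟩ := hb δ hδ0
    have hlim : Tendsto (fun m => b' * (∫⁻ r in Set.Ioi (0 : ℝ), w m r) +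
        C * ∫⁻ r in Set.Ioi δ, w m r) atTop (𝓝 (b' * 1 + C * 0)) :=
      (ENNReal.Tendsto.const_mul h1 (Or.inr hb't)).add
        (ENNReal.Tendsto.const_mul (h0 δ hδ0) (Or.inr hC))
    simp only [mul_one, mul_zero, add_zero] at hlim
    filter_upwards [hlim.eventually (gt_mem_nhds hb'b)] with m hm
    refine lt_of_le_of_lt ?_ hm
    rw [hsplit δ hδ0 (fun r => w m r * Ψ r), ← lintegral_const_mul' _ _ hb't,
      ← lintegral_const_mul' _ _ hC]
    gcongr ?_ + ?_
    · refine (setLIntegral_mono' (g := fun r => b' * w m r) measurableSet_Ioc fun r hr => ?_).trans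
        (lintegral_mono_set Set.Ioc_subset_Ioi_self)
      rw [mul_comm]
      gcongr
      exact (hδΨ hr).le
    · refine setLIntegral_mono' measurableSet_Ioi fun r hr => ?_
      rw [mul_comm]
      gcongr
      exact hCΨ r hr

/-! ### Rotation invariance and the spherical constant -/

theorem exists_linearIsometryEquiv_apply_eq {E : Type*} [NormedAddCommGroup E]
    [InnerProductSpace ℝ E] [CompleteSpace E] {v w : E} (h : ‖v‖ = ‖w‖) :
    ∃ T : E ≃ₗᵢ[ℝ] E, T v = w :=
  ⟨(ℝ ∙ (v - w))ᗮ.reflection, Submodule.reflection_sub h⟩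

/-- The invariance is drawn from Lebesgue measure: by homogeneity the integral of `|v·x|^p` over the
unit ball is the spherical integral times the radial factor `c = ∫₀¹ r^(N-1+p) dr`. A reflection
taking `w` to `v` preserves the ball integral, and `0 < c < ∞` cancels. -/
theorem lintegral_sphere_abs_inner_rpow_congr {N : ℕ} (hN : 1 ≤ N) {p : ℝ} (hp : 0 ≤ p)
    {v w : RN N} (h : ‖v‖ = ‖w‖) :
    ∫⁻ x : Metric.sphere (0 : RN N) 1, ENNReal.ofReal (|inner ℝ v (x : RN N)| ^ p)
        ∂(volume : Measure (RN N)).toSphere =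
      ∫⁻ x : Metric.sphere (0 : RN N) 1, ENNReal.ofReal (|inner ℝ w (x : RN N)| ^ p)
        ∂(volume : Measure (RN N)).toSphere := by
  have : NeZero N := ⟨by omega⟩
  set c : ℝ≥0∞ := ∫⁻ r in Set.Ioi (0 : ℝ), ENNReal.ofReal (r ^ (N - 1)) *
    (Set.Iio (1 : ℝ)).indicator (fun r => ENNReal.ofReal (r ^ p)) r with hcdef
  have key : ∀ v : RN N, ∫⁻ x : RN N, (Metric.ball (0 : RN N) 1).indicator
      (fun x => ENNReal.ofReal (|inner ℝ v x| ^ p)) x =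
      c * ∫⁻ x : Metric.sphere (0 : RN N) 1, ENNReal.ofReal (|inner ℝ v (x : RN N)| ^ p)
        ∂(volume : Measure (RN N)).toSphere := fun v => by
    rw [lintegral_eq_lintegral_Ioi_sphere hN, hcdef, ← lintegral_mul_const]
    · refine setLIntegral_congr_fun measurableSet_Ioi fun r hr => ?_
      have hr' : (0 : ℝ) < r := hr
      simp only [mul_assoc]
      congr 1
      rw [← lintegral_const_mul]
      · refine lintegral_congr fun x => ?_
        by_cases h1 : r < 1
        · simp [Set.indicator, norm_smul, abs_of_pos hr', h1, inner_smul_right, abs_mul,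
            Real.mul_rpow hr'.le (abs_nonneg _), ENNReal.ofReal_mul (Real.rpow_nonneg hr'.le p)]
        · simp [Set.indicator, norm_smul, abs_of_pos hr', h1]
      · fun_prop
    · exact Measurable.mul (by fun_prop) (Measurable.indicator (by fun_prop) measurableSet_Iio)
    · exact (Measurable.indicator (by fun_prop) measurableSet_ball).aemeasurable
  have hct : c ≠ ∞ := by
    refine ne_top_of_le_ne_top (b := ∫⁻ r in Set.Ioo (0 : ℝ) 1, 1) (by simp) ?_
    rw [hcdef, ← lintegral_indicator measurableSet_Ioi, ← lintegral_indicator measurableSet_Ioo]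
    refine lintegral_mono fun r => ?_
    by_cases h0 : 0 < r
    · by_cases h1 : r < 1
      · simp only [Set.indicator, Set.mem_Ioi, h0, h1, Set.mem_Iio, Set.mem_Ioo, if_true,
          and_self]
        refine mul_le_one' ?_ ?_ <;> rw [ENNReal.ofReal_le_one]
        · exact pow_le_one₀ h0.le h1.le
        · exact Real.rpow_le_one h0.le h1.le hp
      · simp [Set.indicator, h1]
    · simp [Set.indicator, h0]
  have hc0 : c ≠ 0 := by
    intro hc
    have hm : Measurable fun r : ℝ => ENNReal.ofReal (r ^ (N - 1)) *
        (Set.Iio (1 : ℝ)).indicator (fun r => ENNReal.ofReal (r ^ p)) r :=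
      Measurable.mul (by fun_prop) (Measurable.indicator (by fun_prop) measurableSet_Iio)
    rw [hcdef, lintegral_eq_zero_iff hm] at hc
    have h2 : volume (Set.Ioo (0 : ℝ) 1) = 0 := by
      rw [measure_eq_zero_iff_ae_notMem]
      filter_upwards [(ae_restrict_iff' measurableSet_Ioi).1 hc] with r hr hr01
      have := hr hr01.1
      simp only [Set.indicator, Set.mem_Iio, hr01.2, if_true, Pi.zero_apply, mul_eq_zero,
        ENNReal.ofReal_eq_zero] at this
      rcases this with h | h
      · exact absurd h (not_le.2 (pow_pos hr01.1 _))
      · exact absurd h (not_le.2 (Real.rpow_pos_of_pos hr01.1 _))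
    simp at h2
  obtain ⟨T, hT⟩ := exists_linearIsometryEquiv_apply_eq h.symm
  rw [← ENNReal.mul_right_inj hc0 hct, ← key, ← key, ← hT,
    ← T.measurePreserving.lintegral_comp_emb T.toHomeomorph.measurableEmbedding]
  refine lintegral_congr fun x => ?_
  simp [Set.indicator, T.inner_map_map]

theorem lintegral_sphere_abs_inner_rpow {N : ℕ} (hN : 1 ≤ N) {p : ℝ} (hp : 1 ≤ p)
    {ω : RN N} (hω : ‖ω‖ = 1) (v : RN N) :
    ∫⁻ x : Metric.sphere (0 : RN N) 1, ENNReal.ofReal (|inner ℝ v (x : RN N)| ^ p)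
        ∂(volume : Measure (RN N)).toSphere =
      ENNReal.ofReal (p * sphereConst p ω) * ENNReal.ofReal (‖v‖ ^ p) := by
  have hp0 : 0 < p := by linarith
  have hK : ENNReal.ofReal (p * sphereConst p ω) =
      ∫⁻ x : Metric.sphere (0 : RN N) 1, ENNReal.ofReal (|inner ℝ ω (x : RN N)| ^ p)
        ∂(volume : Measure (RN N)).toSphere := by
    rw [sphereConst, ← mul_assoc, mul_one_div_cancel hp0.ne', one_mul]
    refine ofReal_integral_eq_lintegral_ofReal ?_ (ae_of_all _ fun x => by positivity)
    refine Integrable.mono' (integrable_const (1 : ℝ))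
      (Measurable.aestronglyMeasurable (by fun_prop)) (ae_of_all _ fun x => ?_)
    rw [Real.norm_of_nonneg (by positivity)]
    refine Real.rpow_le_one (abs_nonneg _) ?_ hp0.le
    have := abs_real_inner_le_norm ω (x : RN N)
    simpa [hω] using this
  have h1 : ‖v‖ = ‖(‖v‖ • ω)‖ := by simp [norm_smul, hω]
  rw [lintegral_sphere_abs_inner_rpow_congr hN hp0.le h1, hK, mul_comm, ← lintegral_const_mul]
  · refine lintegral_congr fun x => ?_
    rw [inner_smul_left, ← ENNReal.ofReal_mul (by positivity),
      ← Real.mul_rpow (by positivity) (by positivity)]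
    simp [abs_mul]
  · fun_prop

/-! ### Directional derivatives and translations in `L^p` -/

/-- The contraction `z ↦ ∑ j, v j * z j` on `ℂ^N`. -/
noncomputable def contraction {N : ℕ} (v : RN N) : CN N →L[ℂ] ℂ :=
  innerSL ℂ (WithLp.toLp 2 (fun j => (v j : ℂ)) : CN N)

theorem contraction_apply {N : ℕ} (v : RN N) (z : CN N) :
    contraction v z = ∑ j, (v j : ℂ) * z j := by
  simp [contraction, PiLp.inner_apply, mul_comm]

theorem norm_contraction_apply_le {N : ℕ} (v : RN N) (z : CN N) :
    ‖contraction v z‖ ≤ ‖v‖ * ‖z‖ := by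
  refine (norm_inner_le_norm (𝕜 := ℂ) (WithLp.toLp 2 (fun j => (v j : ℂ)) : CN N) z).trans (le_of_eq ?_)
  simp [EuclideanSpace.norm_eq]

theorem enorm_contraction_apply_le {N : ℕ} (v : RN N) (z : CN N) :
    ‖contraction v z‖ₑ ≤ ‖v‖ₑ * ‖z‖ₑ := by
  rw [← ofReal_norm, ← ofReal_norm, ← ofReal_norm, ← ENNReal.ofReal_mul (norm_nonneg _)]
  exact ENNReal.ofReal_le_ofReal (norm_contraction_apply_le v z)

theorem contraction_smul {N : ℕ} (a : ℝ) (v : RN N) (z : CN N) :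
    contraction (a • v) z = a * contraction v z := by
  simp [contraction_apply, Finset.mul_sum, mul_assoc]

theorem re_contraction {N : ℕ} (v : RN N) (z : CN N) :
    (contraction v z).re = inner ℝ (WithLp.toLp 2 (fun j => (z j).re) : RN N) v := by
  simp [contraction_apply, PiLp.inner_apply]

theorem im_contraction {N : ℕ} (v : RN N) (z : CN N) :
    (contraction v z).im = inner ℝ (WithLp.toLp 2 (fun j => (z j).im) : RN N) v := by
  simp [contraction_apply, PiLp.inner_apply]

theorem tendsto_eLpNorm_sub_translate {E F : Type*} [NormedAddCommGroup E] [NormedSpace ℝ E]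
    [FiniteDimensional ℝ E] [MeasurableSpace E] [BorelSpace E] [NormedAddCommGroup F]
    {μ : Measure E} [μ.IsAddHaarMeasure]
    {q : ℝ≥0∞} (hq1 : 1 ≤ q) (hq : q ≠ ∞) {f : E → F} (hf : MemLp f q μ) :
    Tendsto (fun k : E => eLpNorm (fun x => f (x + k) - f x) q μ) (𝓝 0) (𝓝 0) := by
  have : Fact (1 ≤ q) := ⟨hq1⟩
  let g : E → C(E, E) := fun k => ⟨fun x => x + k, by fun_prop⟩
  have hg : Continuous g := ContinuousMap.continuous_of_continuous_uncurry _ (by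
    change Continuous fun z : E × E => z.2 + z.1
    fun_prop)
  have hgm : ∀ k, MeasurePreserving (g k) μ μ := fun k => measurePreserving_add_right μ k
  have hc : Continuous fun k => Lp.compMeasurePreserving (g k) (hgm k) (hf.toLp f) :=
    (continuous_const (y := hf.toLp f)).compMeasurePreservingLp hg hgm hq
  have h1 : Tendsto (fun k => ‖Lp.compMeasurePreserving (g k) (hgm k) (hf.toLp f) -
      hf.toLp f‖ₑ) (𝓝 0) (𝓝 0) := by
    have h2 := ((hc.sub (continuous_const (y := hf.toLp f))).enorm).tendsto 0
    have h3 : Lp.compMeasurePreserving (g 0) (hgm 0) (hf.toLp f) = hf.toLp f := by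
      rw [Lp.toLp_compMeasurePreserving hf]
      congr 1
      ext x
      simp [g]
    simpa [h3] using h2
  refine h1.congr fun k => ?_
  rw [Lp.toLp_compMeasurePreserving hf, ← MemLp.toLp_sub, Lp.enorm_toLp]
  rfl

/-- With `u` and `G` vanishing off `Ω`, the integrals run over the whole space and may be translated
freely. The extension need not have a weak gradient there: test functions still live in `Ω`. -/
theorem IsWeakGradient.integral_fderiv_mul {N : ℕ} {Ω : Set (RN N)} {u : RN N → ℂ}
    {G : RN N → CN N} (hw : IsWeakGradient Ω u G) (hu : Integrable u) (hG : Integrable G)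
    (hu0 : ∀ x ∉ Ω, u x = 0) (hG0 : ∀ x ∉ Ω, G x = 0) {φ : RN N → ℝ}
    (hφ : ContDiff ℝ (⊤ : ℕ∞) φ) (hc : HasCompactSupport φ) (hs : tsupport φ ⊆ Ω) (v : RN N) :
    ∫ x, ((fderiv ℝ φ x v : ℝ) : ℂ) * u x = -∫ x, ((φ x : ℝ) : ℂ) * contraction v (G x) := by
  have hd : ∀ w : RN N, Integrable fun x => ((fderiv ℝ φ x w : ℝ) : ℂ) * u x := fun w => by
    have hcont : Continuous fun x => fderiv ℝ φ x w :=
      (hφ.continuous_fderiv (by simp)).clm_apply continuous_const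
    have hcs : HasCompactSupport fun x => fderiv ℝ φ x w := hc.fderiv_apply (𝕜 := ℝ) w
    obtain ⟨C, hC⟩ := hcs.exists_bound_of_continuous hcont
    exact hu.bdd_mul (c := C) (by fun_prop) (ae_of_all _ fun x => by simpa using hC x)
  obtain ⟨C, hC⟩ := hc.exists_bound_of_continuous hφ.continuous
  have hGj : ∀ j, Integrable fun x => ((φ x : ℝ) : ℂ) * G x j := fun j => by
    have h1 : Integrable fun x => G x j :=
      (EuclideanSpace.proj (𝕜 := ℂ) j).integrable_comp hG
    exact h1.bdd_mul (c := C)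
      (Complex.continuous_ofReal.comp hφ.continuous).aestronglyMeasurable
      (ae_of_all _ fun x => by simpa using hC x)
  have hv : ∀ x, fderiv ℝ φ x v = ∑ j, v j * fderiv ℝ φ x (EuclideanSpace.single j 1) := fun x => by
    conv_lhs => rw [← (EuclideanSpace.basisFun (Fin N) ℝ).sum_repr v]
    simp
  calc ∫ x, ((fderiv ℝ φ x v : ℝ) : ℂ) * u x
      = ∫ x, ∑ j, (v j : ℂ) * (((fderiv ℝ φ x (EuclideanSpace.single j 1) : ℝ) : ℂ) * u x) := by
        refine integral_congr_ae (ae_of_all _ fun x => ?_)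
        simp [hv, Finset.sum_mul, mul_assoc]
    _ = ∑ j, (v j : ℂ) * ∫ x in Ω, ((fderiv ℝ φ x (EuclideanSpace.single j 1) : ℝ) : ℂ) * u x := by
        rw [integral_finsetSum _ fun j _ => (hd _).const_mul _]
        refine Finset.sum_congr rfl fun j _ => ?_
        rw [integral_const_mul, setIntegral_eq_integral_of_forall_compl_eq_zero]
        exact fun x hx => by simp [hu0 x hx]
    _ = -∑ j, (v j : ℂ) * ∫ x, ((φ x : ℝ) : ℂ) * G x j := by
        rw [← Finset.sum_neg_distrib]
        refine Finset.sum_congr rfl fun j _ => ?_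
        rw [hw.integral_eq φ hφ hc hs j, mul_neg, setIntegral_eq_integral_of_forall_compl_eq_zero]
        exact fun x hx => by simp [hG0 x hx]
    _ = _ := by
        simp_rw [← integral_const_mul]
        rw [← integral_finsetSum _ fun j _ => (hGj j).const_mul _]
        congr 1
        refine integral_congr_ae (ae_of_all _ fun x => ?_)
        simp only [contraction_apply, Finset.mul_sum]
        exact Finset.sum_congr rfl fun j _ => by ring

/-- This shear gives joint integrability of `(t, x) ↦ G (x + k + t v)`, as Fubini requires. -/
theorem measurePreserving_prod_add_smul {N : ℕ} (ν : Measure ℝ) [SFinite ν] (k v : RN N) :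
    MeasurePreserving (fun z : ℝ × RN N => (z.1, z.2 + (k + z.1 • v)))
      (ν.prod volume) (ν.prod volume) :=
  (MeasurePreserving.id ν).skew_product (g := fun t x => x + (k + t • v))
    (by fun_prop) (ae_of_all _ fun t => (measurePreserving_add_right volume (k + t • v)).map_eq)

/-! ### The fundamental theorem of calculus for weak gradients -/

theorem sub_eq_integral_fderiv_line {N : ℕ} {φ : RN N → ℝ} (hφ : ContDiff ℝ 1 φ) (x v : RN N) :
    φ (x - v) - φ x = ∫ t in Set.Ioc (0 : ℝ) 1, -fderiv ℝ φ (x - t • v) v := by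
  have h := intervalIntegral.integral_eq_sub_of_hasDerivAt (a := 0) (b := 1)
    (f := fun t : ℝ => φ (x - t • v)) (f' := fun t => -fderiv ℝ φ (x - t • v) v) ?_ ?_
  · rw [← intervalIntegral.integral_of_le zero_le_one, h]
    simp
  · intro t _
    have h1 : HasDerivAt (fun t : ℝ => x - t • v) (-v) t := by
      simpa using ((hasDerivAt_id t).smul_const v).const_sub x
    have h2 := ((hφ.differentiable (by simp)) (x - t • v)).hasFDerivAt.comp_hasDerivAt t h1
    simpa [Function.comp_def] using h2
  · refine Continuous.intervalIntegrable ?_ _ _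
    exact (((hφ.continuous_fderiv (by simp)).comp (by fun_prop)).clm_apply continuous_const).neg

/-- By duality: against a test function `φ` supported in `U`, the increment of `u` moves onto `φ`,
where the classical formula along segments applies. Fubini and the weak gradient identity at each
`t` bring the derivative back to `G`. -/
theorem IsWeakGradient.ae_sub_eq_integral {N : ℕ} {Ω U : Set (RN N)} {u : RN N → ℂ}
    {G : RN N → CN N} (hw : IsWeakGradient Ω u G) (hu : Integrable u) (hG : Integrable G)
    (hu0 : ∀ x ∉ Ω, u x = 0) (hG0 : ∀ x ∉ Ω, G x = 0) (hU : IsOpen U) {v : RN N}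
    (hUv : ∀ x ∈ U, ∀ t ∈ Set.Icc (0 : ℝ) 1, x + t • v ∈ Ω) :
    ∀ᵐ x, x ∈ U →
      u (x + v) - u x = ∫ t in Set.Ioc (0 : ℝ) 1, contraction v (G (x + t • v)) := by
  set ν : Measure ℝ := volume.restrict (Set.Ioc 0 1) with hν
  have hGI : Integrable (fun z : ℝ × RN N => contraction v (G (z.2 + z.1 • v)))
      (ν.prod volume) := by
    have h1 := (measurePreserving_prod_add_smul ν 0 v).integrable_comp_of_integrable (hG.comp_snd ν)
    have h2 := (contraction v).integrable_comp h1
    simpa [Function.comp_def] using h2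
  have hI : Integrable (fun x => ∫ t, contraction v (G (x + t • v)) ∂ν) := hGI.integral_prod_right
  have huv : Integrable fun x => u (x + v) := hu.comp_add_right v
  have key := hU.ae_eq_zero_of_integral_contDiff_smul_eq_zero
    (f := fun x => u (x + v) - u x - ∫ t, contraction v (G (x + t • v)) ∂ν)
    (((huv.sub hu).sub hI).locallyIntegrable.locallyIntegrableOn _) ?_
  · filter_upwards [key] with x hx hxU
    exact sub_eq_zero.1 (hx hxU)
  intro φ hφ hc hs
  obtain ⟨C, hC⟩ := hc.exists_bound_of_continuous hφ.continuous
  have hbdd : ∀ {f : RN N → ℂ}, Integrable f → Integrable fun x => ((φ x : ℝ) : ℂ) * f x :=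
    fun hf => hf.bdd_mul (c := C)
      (Complex.continuous_ofReal.comp hφ.continuous).aestronglyMeasurable
       (ae_of_all _ fun x => by simpa using hC x)
  have hφ1 : ContDiff ℝ 1 φ := hφ.of_le (by exact_mod_cast le_top)
  have hcont : Continuous fun x => fderiv ℝ φ x v :=
    (hφ.continuous_fderiv (by simp)).clm_apply continuous_const
  obtain ⟨C', hC'⟩ := (hc.fderiv_apply (𝕜 := ℝ) v).exists_bound_of_continuous hcont
  have hF1 : Integrable (fun z : ℝ × RN N =>
      ((-fderiv ℝ φ (z.2 - z.1 • v) v : ℝ) : ℂ) * u z.2) (ν.prod volume) := by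
    refine (hu.comp_snd ν).bdd_mul (c := C') ?_ (ae_of_all _ fun x => by simpa using hC' _)
    refine Continuous.aestronglyMeasurable ?_
    exact Complex.continuous_ofReal.comp (hcont.comp (by fun_prop)).neg
  have hF2 : Integrable (fun z : ℝ × RN N => ((φ z.2 : ℝ) : ℂ) *
      contraction v (G (z.2 + z.1 • v))) (ν.prod volume) :=
    hGI.bdd_mul (c := C) (by fun_prop) (ae_of_all _ fun x => by simpa using hC _)
  -- The translate `φ(· - t v)` is an admissible test function because `U + t v ⊆ Ω`.
  have htest : ∀ t ∈ Set.Ioc (0 : ℝ) 1,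
      ∫ x, ((-fderiv ℝ φ (x - t • v) v : ℝ) : ℂ) * u x =
        ∫ x, ((φ x : ℝ) : ℂ) * contraction v (G (x + t • v)) := fun t ht => by
    have hψ : ContDiff ℝ (⊤ : ℕ∞) fun x => φ (x - t • v) := hφ.comp (by fun_prop)
    have hψeq : (fun x => φ (x - t • v)) = φ ∘ Homeomorph.addRight (-(t • v)) := by
      ext x; simp [sub_eq_add_neg]
    have hψc : HasCompactSupport fun x => φ (x - t • v) := by
      rw [hψeq]; exact hc.comp_homeomorph _
    have hψs : tsupport (fun x => φ (x - t • v)) ⊆ Ω := by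
      rw [hψeq]
      intro x hx
      have h1 : x - t • v ∈ tsupport φ := by
        have := tsupport_comp_subset_preimage φ
          (Homeomorph.addRight (-(t • v))).continuous hx
        simpa [sub_eq_add_neg] using this
      simpa using hUv _ (hs h1) t ⟨ht.1.le, ht.2⟩
    have h := hw.integral_fderiv_mul hu hG hu0 hG0 hψ hψc hψs v
    have hfd : ∀ x, fderiv ℝ (fun x => φ (x - t • v)) x = fderiv ℝ φ (x - t • v) := fun x => by
      simpa [sub_eq_add_neg] using fderiv_comp_add_right (f := φ) (x := x) (-(t • v))
    simp only [hfd] at h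
    rw [← integral_add_right_eq_self _ (t • v)] at h
    have h3 : ∫ x, ((-fderiv ℝ φ (x - t • v) v : ℝ) : ℂ) * u x =
        -∫ x, ((fderiv ℝ φ (x - t • v) v : ℝ) : ℂ) * u x := by
      rw [← integral_neg]; simp
    rw [h3, ← integral_add_right_eq_self (fun x => ((fderiv ℝ φ (x - t • v) v : ℝ) : ℂ) * u x)
      (t • v), h, neg_neg, ← integral_add_right_eq_self _ (t • v)]
    simp
  have e1 : ∫ x, ((φ (x - v) - φ x : ℝ) : ℂ) * u x =
      ∫ x, ((φ x : ℝ) : ℂ) * ∫ t, contraction v (G (x + t • v)) ∂ν := by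
    calc ∫ x, ((φ (x - v) - φ x : ℝ) : ℂ) * u x
        = ∫ x, ∫ t, ((-fderiv ℝ φ (x - t • v) v : ℝ) : ℂ) * u x ∂ν := by
          refine integral_congr_ae (ae_of_all _ fun x => ?_)
          simp only
          rw [integral_mul_const, integral_complex_ofReal, sub_eq_integral_fderiv_line hφ1]
      _ = ∫ t, (∫ x, ((-fderiv ℝ φ (x - t • v) v : ℝ) : ℂ) * u x) ∂ν :=
          (integral_integral_swap hF1).symm
      _ = ∫ t, (∫ x, ((φ x : ℝ) : ℂ) * contraction v (G (x + t • v))) ∂ν :=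
          setIntegral_congr_fun measurableSet_Ioc htest
      _ = ∫ x, ∫ t, ((φ x : ℝ) : ℂ) * contraction v (G (x + t • v)) ∂ν :=
          integral_integral_swap hF2
      _ = _ := by
          simp_rw [integral_const_mul]
  have e2 : ∫ x, ((φ (x - v) - φ x : ℝ) : ℂ) * u x =
      ∫ x, ((φ x : ℝ) : ℂ) * (u (x + v) - u x) := by
    have i1 : Integrable fun x => ((φ (x - v) : ℝ) : ℂ) * u x :=
      hu.bdd_mul (c := C) (by fun_prop) (ae_of_all _ fun x => by simpa using hC _)
    simp only [Complex.ofReal_sub, sub_mul, mul_sub]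
    rw [integral_sub i1 (hbdd hu), integral_sub (hbdd huv) (hbdd hu)]
    congr 1
    rw [← integral_add_right_eq_self _ v]
    simp
  have e3 : ∫ x, φ x • (u (x + v) - u x - ∫ t, contraction v (G (x + t • v)) ∂ν) =
      (∫ x, ((φ x : ℝ) : ℂ) * (u (x + v) - u x)) -
        ∫ x, ((φ x : ℝ) : ℂ) * ∫ t, contraction v (G (x + t • v)) ∂ν := by
    have i1 : Integrable fun x => ((φ x : ℝ) : ℂ) * (u (x + v) - u x) := hbdd (huv.sub hu)
    rw [← integral_sub i1 (hbdd hI)]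
    refine integral_congr_ae (ae_of_all _ fun x => ?_)
    simp [mul_sub]
  rw [e3, ← e1, e2, sub_self]

theorem rpow_lintegral_enorm_le {α F : Type*} [MeasurableSpace α] [NormedAddCommGroup F]
    {ν : Measure α} [IsProbabilityMeasure ν] {p : ℝ} (hp : 1 ≤ p) {f : α → F}
    (hf : AEStronglyMeasurable f ν) :
    (∫⁻ a, ‖f a‖ₑ ∂ν) ^ p ≤ ∫⁻ a, ‖f a‖ₑ ^ p ∂ν := by
  have hp0 : 0 < p := by linarith
  have h := eLpNorm'_le_eLpNorm'_of_exponent_le one_pos hp ν hf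
  simp only [eLpNorm', ENNReal.rpow_one, div_one] at h
  calc (∫⁻ a, ‖f a‖ₑ ∂ν) ^ p ≤ ((∫⁻ a, ‖f a‖ₑ ^ p ∂ν) ^ (1 / p)) ^ p := by gcongr
    _ = _ := by rw [← ENNReal.rpow_mul, one_div_mul_cancel hp0.ne', ENNReal.rpow_one]

theorem eLpNorm_ofReal_eq {α F : Type*} [MeasurableSpace α] [NormedAddCommGroup F]
    {μ : Measure α} {p : ℝ} (hp : 1 ≤ p) (f : α → F) :
    eLpNorm f (ENNReal.ofReal p) μ = (∫⁻ a, ‖f a‖ₑ ^ p ∂μ) ^ (1 / p) := by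
  have hp0 : 0 < p := by linarith
  rw [eLpNorm_eq_lintegral_rpow_enorm_toReal (by simpa using hp0) ENNReal.ofReal_ne_top,
    ENNReal.toReal_ofReal hp0.le]

theorem eLpNorm_ofReal_rpow {α F : Type*} [MeasurableSpace α] [NormedAddCommGroup F]
    {μ : Measure α} {p : ℝ} (hp : 1 ≤ p) (f : α → F) :
    eLpNorm f (ENNReal.ofReal p) μ ^ p = ∫⁻ a, ‖f a‖ₑ ^ p ∂μ := by
  rw [eLpNorm_ofReal_eq hp, ← ENNReal.rpow_mul, one_div_mul_cancel (by linarith), ENNReal.rpow_one]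

theorem eLpNorm_restrict_union_le {α F : Type*} [MeasurableSpace α] [NormedAddCommGroup F]
    {μ : Measure α} {p : ℝ} (hp : 1 ≤ p) (f : α → F) (s t : Set α) :
    eLpNorm f (ENNReal.ofReal p) (μ.restrict (s ∪ t)) ≤
      eLpNorm f (ENNReal.ofReal p) (μ.restrict s) + eLpNorm f (ENNReal.ofReal p) (μ.restrict t) := by
  have hp0 : 0 < p := by linarith
  simp only [eLpNorm_ofReal_eq hp]
  exact (ENNReal.rpow_le_rpow (lintegral_union_le _ _ _) (by positivity)).trans
    (ENNReal.rpow_add_le_add_rpow _ _ (by positivity) ((div_le_one hp0).2 hp))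

/-- The remainder is the average over `t` of `v·(G(x+k+tv) - G(x))`; Jensen in `t` and Tonelli bound
it by the `L^p` translation modulus. The offset `k` serves the legs of a detour: they start at `x +
k` but are compared with the gradient at `x`. -/
theorem IsWeakGradient.eLpNorm_sub_sub_contraction_le {N : ℕ} {Ω U : Set (RN N)} {u : RN N → ℂ}
    {G : RN N → CN N} (hw : IsWeakGradient Ω u G) (hu : Integrable u) (hG : Integrable G)
    (hGm : Measurable G) (hu0 : ∀ x ∉ Ω, u x = 0) (hG0 : ∀ x ∉ Ω, G x = 0) (hU : IsOpen U)
    {p : ℝ} (hp : 1 ≤ p) {k v : RN N}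
    (hUv : ∀ x ∈ U, ∀ t ∈ Set.Icc (0 : ℝ) 1, x + (k + t • v) ∈ Ω) {M : ℝ≥0∞}
    (hM : ∀ t ∈ Set.Icc (0 : ℝ) 1,
      eLpNorm (fun x => G (x + (k + t • v)) - G x) (ENNReal.ofReal p) volume ≤ M) :
    eLpNorm (fun x => u (x + k + v) - u (x + k) - contraction v (G x)) (ENNReal.ofReal p)
      (volume.restrict U) ≤ ‖v‖ₑ * M := by
  have hp0 : 0 < p := by linarith
  set ν : Measure ℝ := volume.restrict (Set.Ioc 0 1) with hν
  have : IsProbabilityMeasure ν := ⟨by simp [hν]⟩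
  have hshift : IsOpen ((fun y => y - k) ⁻¹' U) := hU.preimage (by fun_prop)
  have h1 := hw.ae_sub_eq_integral hu hG hu0 hG0 hshift (v := v) (fun y hy t ht => by
    have := hUv _ hy t ht
    rwa [← add_assoc, sub_add_cancel] at this)
  have h2 : ∀ᵐ x, x ∈ U → u (x + k + v) - u (x + k) =
      ∫ t, contraction v (G (x + (k + t • v))) ∂ν := by
    filter_upwards [(measurePreserving_add_right volume k).quasiMeasurePreserving.ae h1]
      with x hx hxU
    rw [hx (by simpa using hxU)]
    simp only [add_assoc, hν]
  have hGI : ∀ᵐ x, Integrable (fun t => G (x + (k + t • v))) ν :=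
    ((measurePreserving_prod_add_smul ν k v).integrable_comp_of_integrable
      (hG.comp_snd ν)).prod_left_ae
  have h3 : ∀ᵐ x, x ∈ U → ‖u (x + k + v) - u (x + k) - contraction v (G x)‖ₑ ^ p ≤
      ‖v‖ₑ ^ p * ∫⁻ t, ‖G (x + (k + t • v)) - G x‖ₑ ^ p ∂ν := by
    filter_upwards [h2, hGI] with x hx hxI hxU
    have hd : Integrable (fun t => G (x + (k + t • v)) - G x) ν := hxI.sub (integrable_const _)
    have e : u (x + k + v) - u (x + k) - contraction v (G x) =
        ∫ t, contraction v (G (x + (k + t • v)) - G x) ∂ν := by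
      simp only [map_sub]
      rw [hx hxU, integral_sub ((contraction v).integrable_comp hxI) (integrable_const _)]
      simp
    rw [e]
    calc _ ≤ (∫⁻ t, ‖contraction v (G (x + (k + t • v)) - G x)‖ₑ ∂ν) ^ p := by
          gcongr
          exact enorm_integral_le_lintegral_enorm _
      _ ≤ (‖v‖ₑ * ∫⁻ t, ‖G (x + (k + t • v)) - G x‖ₑ ∂ν) ^ p := by
          rw [← lintegral_const_mul' _ _ enorm_ne_top]
          gcongr with t
          exact enorm_contraction_apply_le _ _
      _ ≤ _ := by
          rw [ENNReal.mul_rpow_of_nonneg _ _ hp0.le]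
          gcongr
          exact rpow_lintegral_enorm_le hp hd.aestronglyMeasurable
  have h4 : ∫⁻ x in U, ‖u (x + k + v) - u (x + k) - contraction v (G x)‖ₑ ^ p ≤
      (‖v‖ₑ * M) ^ p := by
    calc _ ≤ ∫⁻ x in U, ‖v‖ₑ ^ p * ∫⁻ t, ‖G (x + (k + t • v)) - G x‖ₑ ^ p ∂ν :=
          lintegral_mono_ae ((ae_restrict_iff' hU.measurableSet).2 h3)
      _ ≤ ∫⁻ x, ‖v‖ₑ ^ p * ∫⁻ t, ‖G (x + (k + t • v)) - G x‖ₑ ^ p ∂ν :=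
          lintegral_mono' Measure.restrict_le_self le_rfl
      _ = ‖v‖ₑ ^ p * ∫⁻ x, ∫⁻ t, ‖G (x + (k + t • v)) - G x‖ₑ ^ p ∂ν :=
          lintegral_const_mul' _ _ (by simp [hp0.le])
      _ = ‖v‖ₑ ^ p * ∫⁻ t, (∫⁻ x, ‖G (x + (k + t • v)) - G x‖ₑ ^ p) ∂ν := by
          rw [lintegral_lintegral_swap]
          exact Measurable.aemeasurable (by fun_prop)
      _ ≤ ‖v‖ₑ ^ p * ∫⁻ t, M ^ p ∂ν := by
          refine mul_le_mul_right ?_ _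
          refine setLIntegral_mono' measurableSet_Ioc fun t ht => ?_
          rw [← eLpNorm_ofReal_rpow hp]
          gcongr
          exact hM t ⟨ht.1.le, ht.2⟩
      _ = _ := by simp [ENNReal.mul_rpow_of_nonneg _ _ hp0.le]
  rw [eLpNorm_ofReal_eq hp]
  refine (ENNReal.rpow_le_rpow h4 (by positivity)).trans (le_of_eq ?_)
  rw [← ENNReal.rpow_mul, mul_one_div_cancel hp0.ne', ENNReal.rpow_one]

/-! ### Taylor remainder up to the Lipschitz boundary -/

/-- The step `v` lowers the height by at most `‖v‖` and raises the graph below by at most `L‖v‖`, so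
a lift of `(L + 1)‖v‖` compensates both. -/
theorem add_smul_mem_of_lipschitz_epigraph {N : ℕ} {Ω : Set (RN N)} {x₀ e : RN N}
    {r : ℝ} {L : ℝ≥0} {γ : RN N → ℝ} (he : ‖e‖ = 1) (hγ : LipschitzWith L γ)
    (h : ∀ y ∈ Metric.ball x₀ r, (y ∈ Ω ↔ γ (y - inner ℝ e y • e) < inner ℝ e y))
    {x v : RN N} {s : ℝ} (hx : x ∈ Ω) (hxb : x ∈ Metric.ball x₀ r)
    (hsv : (L + 1) * ‖v‖ ≤ s) (hb : x + (s • e + v) ∈ Metric.ball x₀ r) :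
    x + (s • e + v) ∈ Ω := by
  rw [h _ hb]
  have hx' := (h x hxb).1 hx
  have hee : inner ℝ e e = (1 : ℝ) := by simp [he]
  have e1 : inner ℝ e (x + (s • e + v)) = inner ℝ e x + s + inner ℝ e v := by
    simp only [inner_add_right, inner_smul_right, hee]; ring
  have hproj : ‖v - inner ℝ e v • e‖ ≤ ‖v‖ := by
    have h1 : ‖v - inner ℝ e v • e‖ ^ 2 = ‖v‖ ^ 2 - inner ℝ e v ^ 2 := by
      rw [norm_sub_sq_real, norm_smul, he, inner_smul_right, real_inner_comm e v]
      simp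
      ring
    refine abs_le_of_sq_le_sq' ?_ (norm_nonneg _) |>.2
    rw [h1]
    nlinarith [sq_nonneg (inner ℝ e v : ℝ)]
  have e2 : x + (s • e + v) - inner ℝ e (x + (s • e + v)) • e =
      (x - inner ℝ e x • e) + (v - inner ℝ e v • e) := by
    rw [e1]
    simp only [add_smul]
    abel
  have h2 := hγ.dist_le_mul ((x - inner ℝ e x • e) + (v - inner ℝ e v • e)) (x - inner ℝ e x • e)
  rw [Real.dist_eq, dist_eq_norm, add_sub_cancel_left] at h2
  have h3 := (abs_le.1 h2).2
  have h4 := neg_le_of_abs_le (abs_real_inner_le_norm e v)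
  rw [he, one_mul] at h4
  have h5 : (L : ℝ) * ‖v - inner ℝ e v • e‖ ≤ L * ‖v‖ := by gcongr
  rw [e2, e1]
  linarith

theorem IsWeakGradient.exists_forall_eLpNorm_sub_le {N : ℕ} {Ω : Set (RN N)} (hΩ : IsOpen Ω)
    (hΩb : Bornology.IsBounded Ω) (hΩl : HasLipschitzBoundary Ω) {u : RN N → ℂ}
    {G : RN N → CN N} (hw : IsWeakGradient Ω u G) (hu : Integrable u) (hum : Measurable u)
    (hG : Integrable G)
    (hGm : Measurable G) (hu0 : ∀ x ∉ Ω, u x = 0) (hG0 : ∀ x ∉ Ω, G x = 0)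
    {p : ℝ} (hp : 1 ≤ p) (hGp : MemLp G (ENNReal.ofReal p) volume) {ε : ℝ≥0∞} (hε : 0 < ε) :
    ∃ δ : ℝ, 0 < δ ∧ ∀ h : RN N, ‖h‖ < δ →
      eLpNorm (fun x => u (x + h) - u x - contraction h (G x)) (ENNReal.ofReal p)
        (volume.restrict (Ω ∩ {x | x + h ∈ Ω})) ≤ ‖h‖ₑ * ε := by
  have hp1 : 1 ≤ ENNReal.ofReal p := by simpa using hp
  have hmod : ∀ M : ℝ≥0∞, 0 < M → ∃ δ : ℝ, 0 < δ ∧ ∀ k : RN N, ‖k‖ < δ →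
      eLpNorm (fun x => G (x + k) - G x) (ENNReal.ofReal p) volume ≤ M := fun M hM => by
    have h1 := (tendsto_eLpNorm_sub_translate hp1 ENNReal.ofReal_ne_top hGp).eventually
      (ge_mem_nhds hM)
    obtain ⟨δ, hδ, h2⟩ := Metric.eventually_nhds_iff.1 h1
    exact ⟨δ, hδ, fun k hk => h2 (by simpa using hk)⟩
  have hopen : ∀ h : RN N, IsOpen {x | x + h ∈ Ω} := fun h => hΩ.preimage (by fun_prop)
  have hcm : ∀ h, Measurable fun x => contraction h (G x) := fun h =>
    (contraction h).continuous.measurable.comp hGm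
  -- `P` passes to subsets and finite unions, so by compactness of the closure it need only be
  -- checked near each point.
  let P : Set (RN N) → Prop := fun V => ∀ ε : ℝ≥0∞, 0 < ε → ∃ δ : ℝ, 0 < δ ∧ ∀ h : RN N, ‖h‖ < δ →
    eLpNorm (fun x => u (x + h) - u x - contraction h (G x)) (ENNReal.ofReal p)
      (volume.restrict (V ∩ (Ω ∩ {x | x + h ∈ Ω}))) ≤ ‖h‖ₑ * ε
  have hP : P (closure Ω) := by
    refine hΩb.isCompact_closure.induction_on (p := P) ?_ ?_ ?_ ?_
    · exact fun ε _ => ⟨1, one_pos, fun h _ => by simp⟩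
    · intro s t hst ht ε hε
      obtain ⟨δ, hδ, H⟩ := ht ε hε
      refine ⟨δ, hδ, fun h hh => le_trans (eLpNorm_mono_measure _ ?_) (H h hh)⟩
      exact Measure.restrict_mono (by gcongr) le_rfl
    · intro s t hs ht ε hε
      obtain ⟨δ, hδ, H⟩ := hs (ε / 2) (ENNReal.half_pos hε.ne')
      obtain ⟨δ', hδ', H'⟩ := ht (ε / 2) (ENNReal.half_pos hε.ne')
      refine ⟨min δ δ', lt_min hδ hδ', fun h hh => ?_⟩
      rw [Set.union_inter_distrib_right]
      refine (eLpNorm_restrict_union_le hp _ _ _).trans ?_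
      refine (add_le_add (H h (hh.trans_le (min_le_left _ _)))
        (H' h (hh.trans_le (min_le_right _ _)))).trans (le_of_eq ?_)
      rw [← mul_add, ENNReal.add_halves]
    · intro x₀ hx₀
      by_cases hxΩ : x₀ ∈ Ω
      · obtain ⟨r, hr, hball⟩ := Metric.isOpen_iff.1 hΩ x₀ hxΩ
        refine ⟨Metric.ball x₀ (r / 2), mem_nhdsWithin_of_mem_nhds
          (Metric.ball_mem_nhds _ (by positivity)), fun ε hε => ?_⟩
        obtain ⟨δ, hδ, H⟩ := hmod ε hε
        refine ⟨min δ (r / 2), by positivity, fun h hh => ?_⟩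
        have hh1 := hh.trans_le (min_le_left _ _)
        have hh2 := hh.trans_le (min_le_right _ _)
        have hth : ∀ t ∈ Set.Icc (0 : ℝ) 1, ‖0 + t • h‖ ≤ ‖h‖ := fun t ht => by
          rw [zero_add, norm_smul, Real.norm_of_nonneg ht.1]
          exact mul_le_of_le_one_left (norm_nonneg _) ht.2
        have := hw.eLpNorm_sub_sub_contraction_le hu hG hGm hu0 hG0
          (Metric.isOpen_ball (x := x₀) (ε := r / 2)) hp (k := 0) (v := h)
          (fun x hx t ht => hball ?_) (M := ε) (fun t ht => H _ ((hth t ht).trans_lt hh1))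
        · simp only [add_zero] at this
          refine le_trans (eLpNorm_mono_measure _ ?_) this
          exact Measure.restrict_mono Set.inter_subset_left le_rfl
        · rw [mem_ball_iff_norm] at hx ⊢
          calc ‖x + (0 + t • h) - x₀‖ = ‖(x - x₀) + (0 + t • h)‖ := by congr 1; abel
            _ ≤ ‖x - x₀‖ + ‖0 + t • h‖ := norm_add_le _ _
            _ < r := by linarith [hth t ht]
      · have hfr : x₀ ∈ frontier Ω := by rw [hΩ.frontier_eq]; exact ⟨hx₀, hxΩ⟩
        obtain ⟨r, hr, e, he, L, γ, hγ, hch⟩ := hΩl x₀ hfr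
        refine ⟨Metric.ball x₀ (r / 2), mem_nhdsWithin_of_mem_nhds
          (Metric.ball_mem_nhds _ (by positivity)), fun ε hε => ?_⟩
        -- The three legs have lengths `(L+1)‖h‖`, `‖h‖` and `(L+1)‖h‖`, in total `(2L+3)‖h‖`.
        obtain ⟨δ, hδ, H⟩ := hmod (ε / (2 * L + 3)) (ENNReal.div_pos hε.ne' (by finiteness))
        have hL : (0 : ℝ) < L + 2 := by positivity
        -- Every point of the detour is within `(L+2)‖h‖` of `x`, so it stays in the chart and
        -- within reach of the translation modulus.
        refine ⟨min δ (r / 2) / (L + 2), by positivity, fun h hh => ?_⟩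
        rw [lt_div_iff₀ hL] at hh
        have hh1 := hh.trans_le (min_le_left _ _)
        have hh2 := hh.trans_le (min_le_right _ _)
        set s : ℝ := (L + 1) * ‖h‖ with hs
        have hs0 : 0 ≤ s := by positivity
        have hsum : s + ‖h‖ = ‖h‖ * (L + 2) := by rw [hs]; ring
        set U := Metric.ball x₀ (r / 2) ∩ (Ω ∩ {x | x + h ∈ Ω}) with hUdef
        have hUo : IsOpen U := Metric.isOpen_ball.inter (hΩ.inter (hopen h))
        have hnse : ∀ t ∈ Set.Icc (0 : ℝ) 1, ‖t • s • e‖ ≤ s := fun t ht => by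
          rw [norm_smul, norm_smul, he, mul_one, Real.norm_of_nonneg ht.1, Real.norm_of_nonneg hs0]
          exact mul_le_of_le_one_left hs0 ht.2
        have hnh : ∀ t ∈ Set.Icc (0 : ℝ) 1, ‖t • h‖ ≤ ‖h‖ := fun t ht => by
          rw [norm_smul, Real.norm_of_nonneg ht.1]
          exact mul_le_of_le_one_left (norm_nonneg _) ht.2
        have hse : ‖s • e‖ = s := by rw [norm_smul, he, mul_one, Real.norm_of_nonneg hs0]
        have hinball : ∀ x ∈ U, ∀ k : RN N, ‖k‖ ≤ s + ‖h‖ → x + k ∈ Metric.ball x₀ r := by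
          intro x hx k hk
          have hx1 := hx.1
          rw [mem_ball_iff_norm] at hx1 ⊢
          calc ‖x + k - x₀‖ = ‖(x - x₀) + k‖ := by congr 1; abel
            _ ≤ ‖x - x₀‖ + ‖k‖ := norm_add_le _ _
            _ < r := by linarith
        have n1 : ∀ t ∈ Set.Icc (0 : ℝ) 1, ‖0 + t • s • e‖ ≤ s + ‖h‖ := fun t ht => by
          rw [zero_add]; linarith [hnse t ht, norm_nonneg h]
        have n2 : ∀ t ∈ Set.Icc (0 : ℝ) 1, ‖s • e + t • h‖ ≤ s + ‖h‖ := fun t ht =>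
          (norm_add_le _ _).trans (by linarith [hnh t ht])
        have n3 : ∀ t ∈ Set.Icc (0 : ℝ) 1, ‖h + t • s • e‖ ≤ s + ‖h‖ := fun t ht =>
          (norm_add_le _ _).trans (by linarith [hnse t ht])
        have l1 := hw.eLpNorm_sub_sub_contraction_le hu hG hGm hu0 hG0 hUo hp (k := 0)
          (v := s • e) (M := ε / (2 * L + 3)) (fun x hx t ht => by
            have hb := hinball x hx _ (n1 t ht)
            have hx0 := hinball x hx 0 (by rw [norm_zero]; positivity)
            rw [add_zero] at hx0
            have e1 : (0 : RN N) + t • s • e = (t * s) • e + 0 := by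
              rw [smul_smul, add_zero, zero_add]
            rw [e1] at hb ⊢
            exact add_smul_mem_of_lipschitz_epigraph he hγ hch hx.2.1 hx0
              (by rw [norm_zero, mul_zero]; exact mul_nonneg ht.1 hs0) hb)
          (fun t ht => H _ ((n1 t ht).trans_lt (by linarith)))
        have l2 := hw.eLpNorm_sub_sub_contraction_le hu hG hGm hu0 hG0 hUo hp (k := s • e)
          (v := h) (M := ε / (2 * L + 3)) (fun x hx t ht => by
            have hb := hinball x hx _ (n2 t ht)
            have hx0 := hinball x hx 0 (by rw [norm_zero]; positivity)
            rw [add_zero] at hx0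
            refine add_smul_mem_of_lipschitz_epigraph he hγ hch hx.2.1 hx0 ?_ hb
            have := hnh t ht
            rw [hs]
            gcongr)
          (fun t ht => H _ ((n2 t ht).trans_lt (by linarith)))
        have l3 := hw.eLpNorm_sub_sub_contraction_le hu hG hGm hu0 hG0 hUo hp (k := h)
          (v := s • e) (M := ε / (2 * L + 3)) (fun x hx t ht => by
            have hb := hinball x hx _ (n3 t ht)
            have hx0 := hinball x hx h (by linarith)
            have e1 : x + (h + t • s • e) = (x + h) + ((t * s) • e + 0) := by
              rw [smul_smul, add_zero, add_assoc]
            rw [e1] at hb ⊢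
            exact add_smul_mem_of_lipschitz_epigraph he hγ hch hx.2.2 hx0
              (by rw [norm_zero, mul_zero]; exact mul_nonneg ht.1 hs0) hb)
          (fun t ht => H _ ((n3 t ht).trans_lt (by linarith)))
        -- Telescoping along the detour. The linear terms of the two vertical legs cancel exactly
        -- because every leg uses the gradient at the same point `x`.
        have hdec : (fun x => u (x + h) - u x - contraction h (G x)) =
            (((fun x => u (x + 0 + s • e) - u (x + 0) - contraction (s • e) (G x)) +
              fun x => u (x + s • e + h) - u (x + s • e) - contraction h (G x)) -
              fun x => u (x + h + s • e) - u (x + h) - contraction (s • e) (G x)) := by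
          ext x
          simp only [Pi.add_apply, Pi.sub_apply, add_zero, add_right_comm x h (s • e)]
          ring
        have m1 : ∀ k v, Measurable fun x => u (x + k + v) - u (x + k) - contraction v (G x) :=
          fun k v => by
            have := hcm v
            fun_prop
        have es : ‖s • e‖ₑ = (L + 1) * ‖h‖ₑ := by
          rw [← ofReal_norm, hse, hs, ENNReal.ofReal_mul (by positivity), ofReal_norm,
            ENNReal.ofReal_add (by positivity) zero_le_one]
          simp
        rw [hdec]
        refine (eLpNorm_sub_le ((m1 _ _).add (m1 _ _)).aestronglyMeasurable
          (m1 _ _).aestronglyMeasurable hp1).trans ?_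
        refine (add_le_add ((eLpNorm_add_le (m1 _ _).aestronglyMeasurable
          (m1 _ _).aestronglyMeasurable hp1).trans (add_le_add l1 l2)) l3).trans ?_
        rw [es]
        calc _ = ‖h‖ₑ * ((2 * L + 3) * (ε / (2 * L + 3))) := by ring
          _ ≤ _ := by
            gcongr
            exact ENNReal.mul_div_le
  obtain ⟨δ, hδ, H⟩ := hP ε hε
  refine ⟨δ, hδ, fun h hh => ?_⟩
  have := H h hh
  rwa [← Set.inter_assoc, Set.inter_eq_self_of_subset_right subset_closure] at this

/-! ### The magnetic phase -/

theorem contraction_magneticGradient {N : ℕ} (A : RN N → RN N) (u : RN N → ℂ) (G : RN N → CN N)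
    (h x : RN N) : contraction h (magneticGradient A u G x) =
      contraction h (G x) - Complex.I * ((inner ℝ h (A x) : ℝ) : ℂ) * u x := by
  simp only [contraction_apply, magneticGradient, mul_sub, Finset.sum_sub_distrib,
    PiLp.inner_apply, Complex.ofReal_sum, Finset.mul_sum, Finset.sum_mul]
  congr 1
  refine Finset.sum_congr rfl fun j _ => ?_
  simp
  ring

/-- The exponential has a quadratic remainder in the phase, which is `O(|h|)`; replacing the
midpoint value of `A` by `A x` costs `o(|h|)` by uniform continuity on a ball slightly larger than
`Ω`. -/
theorem exists_forall_norm_phase_le {N : ℕ} {Ω : Set (RN N)} (hΩb : Bornology.IsBounded Ω)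
    {A : RN N → RN N} (hA : Continuous A) {ε : ℝ} (hε : 0 < ε) :
    ∃ δ : ℝ, 0 < δ ∧ ∀ h : RN N, ‖h‖ < δ → ∀ x ∈ Ω,
      ‖1 - Complex.exp (Complex.I * ((inner ℝ h (A ((1 / 2 : ℝ) • (x + h + x))) : ℝ) : ℂ)) +
        Complex.I * ((inner ℝ h (A x) : ℝ) : ℂ)‖ ≤ ‖h‖ * ε := by
  obtain ⟨R, hR⟩ := hΩb.subset_closedBall 0
  have hK : IsCompact (Metric.closedBall (0 : RN N) (R + 1)) := isCompact_closedBall _ _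
  obtain ⟨C, hC⟩ := hK.exists_bound_of_continuousOn hA.continuousOn
  have hC0 : 0 ≤ max C 0 := le_max_right _ _
  have huc := hK.uniformContinuousOn_of_continuous hA.continuousOn
  obtain ⟨δ, hδ, H⟩ := Metric.uniformContinuousOn_iff.1 huc (ε / 2) (by positivity)
  set D := max C 0 + 1 with hD
  have hD0 : 0 < D := by positivity
  -- In order: uniform continuity of `A`, midpoints inside radius `R + 1`, phase of modulus at most
  -- `1`, and quadratic remainder at most `‖h‖ ε / 2`.
  refine ⟨min (min δ 1) (min (1 / D) (ε / (2 * D ^ 2))), by positivity, fun h hh x hx => ?_⟩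
  simp only [lt_min_iff] at hh
  obtain ⟨⟨h1, h2⟩, h3, h4⟩ := hh
  have hmid : (1 / 2 : ℝ) • (x + h + x) = x + (1 / 2 : ℝ) • h := by module
  rw [hmid]
  have hxR : ‖x‖ ≤ R := by simpa using hR hx
  have hhalf : ‖(1 / 2 : ℝ) • h‖ ≤ ‖h‖ := by
    rw [norm_smul]; norm_num
    linarith [norm_nonneg h]
  have hxm : x ∈ Metric.closedBall (0 : RN N) (R + 1) := by
    rw [mem_closedBall_zero_iff]; linarith
  have hym : x + (1 / 2 : ℝ) • h ∈ Metric.closedBall (0 : RN N) (R + 1) := by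
    rw [mem_closedBall_zero_iff]
    linarith [norm_add_le x ((1 / 2 : ℝ) • h)]
  have hd := H _ hym x hxm (by rw [dist_eq_norm, add_sub_cancel_left]; linarith)
  rw [dist_eq_norm] at hd
  set y := x + (1 / 2 : ℝ) • h
  have hAy : ‖A y‖ ≤ D := (hC y hym).trans (by rw [hD]; linarith [le_max_left C 0])
  have hθ : ‖Complex.I * ((inner ℝ h (A y) : ℝ) : ℂ)‖ ≤ ‖h‖ * D := by
    simp only [norm_mul, Complex.norm_I, one_mul, Complex.norm_real]
    exact (norm_inner_le_norm _ _).trans (by gcongr)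
  have hhD : ‖h‖ * D < 1 := by rwa [lt_div_iff₀ hD0] at h3
  have e := Complex.norm_exp_sub_one_sub_id_le (hθ.trans hhD.le)
  have e2 : 1 - Complex.exp (Complex.I * ((inner ℝ h (A y) : ℝ) : ℂ)) +
      Complex.I * ((inner ℝ h (A x) : ℝ) : ℂ) =
      -(Complex.exp (Complex.I * ((inner ℝ h (A y) : ℝ) : ℂ)) - 1 -
        Complex.I * ((inner ℝ h (A y) : ℝ) : ℂ)) -
        Complex.I * ((inner ℝ h (A y - A x) : ℝ) : ℂ) := by
    rw [inner_sub_right]; push_cast; ring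
  have e3 : ‖Complex.I * ((inner ℝ h (A y - A x) : ℝ) : ℂ)‖ ≤ ‖h‖ * (ε / 2) := by
    simp only [norm_mul, Complex.norm_I, one_mul, Complex.norm_real]
    exact (norm_inner_le_norm _ _).trans (by gcongr)
  have e4 : (‖h‖ * D) ^ 2 ≤ ‖h‖ * (ε / 2) := by
    rw [lt_div_iff₀ (by positivity)] at h4
    nlinarith [norm_nonneg h]
  rw [e2]
  refine (norm_sub_le _ _).trans ?_
  rw [norm_neg]
  have e5 : ‖Complex.I * ((inner ℝ h (A y) : ℝ) : ℂ)‖ ^ 2 ≤ (‖h‖ * D) ^ 2 := by gcongr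
  linarith

theorem measurable_magneticDiff {N : ℕ} {A : RN N → RN N} (hA : Continuous A) {u : RN N → ℂ}
    (hum : Measurable u) :
    Measurable fun z : RN N × RN N => magneticDiff A u (z.2 + z.1) z.2 := by
  unfold magneticDiff
  have := hA.measurable
  fun_prop

theorem measurable_magneticGradient {N : ℕ} {A : RN N → RN N} (hA : Continuous A) {u : RN N → ℂ}
    (hum : Measurable u) {G : RN N → CN N} (hGm : Measurable G) :
    Measurable (magneticGradient A u G) := by
  unfold magneticGradient
  have := hA.measurable
  refine (WithLp.measurable_toLp 2 _).comp (measurable_pi_lambda _ fun j => ?_)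
  fun_prop

theorem IsWeakGradient.exists_forall_eLpNorm_magneticDiff_sub_le {N : ℕ} {Ω : Set (RN N)}
    (hΩ : IsOpen Ω) (hΩb : Bornology.IsBounded Ω) (hΩl : HasLipschitzBoundary Ω) {u : RN N → ℂ}
    {G : RN N → CN N} {A : RN N → RN N} (hA : Continuous A)
    (hw : IsWeakGradient Ω u G) (hu : Integrable u) (hum : Measurable u)
    (hG : Integrable G) (hGm : Measurable G) (hu0 : ∀ x ∉ Ω, u x = 0) (hG0 : ∀ x ∉ Ω, G x = 0)
    {p : ℝ} (hp : 1 ≤ p) (hup : MemLp u (ENNReal.ofReal p) volume)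
    (hGp : MemLp G (ENNReal.ofReal p) volume) {ε : ℝ≥0∞} (hε : 0 < ε) :
    ∃ δ : ℝ, 0 < δ ∧ ∀ h : RN N, ‖h‖ < δ →
      eLpNorm (fun x => magneticDiff A u (x + h) x - contraction h (magneticGradient A u G x))
        (ENNReal.ofReal p) (volume.restrict (Ω ∩ {x | x + h ∈ Ω})) ≤ ‖h‖ₑ * ε := by
  have hp1 : 1 ≤ ENNReal.ofReal p := by simpa using hp
  obtain ⟨δ, hδ, H⟩ := hw.exists_forall_eLpNorm_sub_le hΩ hΩb hΩl hu hum hG hGm hu0 hG0 hp hGp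
    (ENNReal.half_pos hε.ne')
  obtain ⟨η, hη, hηε⟩ : ∃ η : ℝ≥0, 0 < η ∧
      η * eLpNorm u (ENNReal.ofReal p) volume ≤ ε / 2 := by
    obtain ⟨η, hη, h⟩ := ENNReal.exists_nnreal_pos_mul_lt hup.eLpNorm_ne_top
      (ENNReal.half_pos hε.ne').ne'
    exact ⟨η, hη, h.le⟩
  obtain ⟨δ', hδ', H'⟩ := exists_forall_norm_phase_le hΩb hA (ε := η) hη
  refine ⟨min δ δ', lt_min hδ hδ', fun h hh => ?_⟩
  have hh1 := hh.trans_le (min_le_left _ _)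
  have hh2 := hh.trans_le (min_le_right _ _)
  set ph : RN N → ℂ := fun x =>
    1 - Complex.exp (Complex.I * ((inner ℝ h (A ((1 / 2 : ℝ) • (x + h + x))) : ℝ) : ℂ)) +
        Complex.I * ((inner ℝ h (A x) : ℝ) : ℂ) with hph
  have hdec : (fun x => magneticDiff A u (x + h) x - contraction h (magneticGradient A u G x)) =
      (fun x => u (x + h) - u x - contraction h (G x)) + fun x => ph x * u x := by
    ext x
    simp only [magneticDiff, contraction_magneticGradient, Pi.add_apply, hph, add_sub_cancel_left]
    ring
  have hAm := hA.measurable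
  have hm1 : Measurable fun x => u (x + h) - u x - contraction h (G x) := by
    have := (contraction h).continuous.measurable.comp hGm
    simp only [Function.comp_def] at this
    fun_prop
  have hm2 : Measurable fun x => ph x * u x := by
    simp only [hph]
    fun_prop
  rw [hdec]
  refine (eLpNorm_add_le hm1.aestronglyMeasurable hm2.aestronglyMeasurable hp1).trans ?_
  rw [← ENNReal.add_halves ε, mul_add]
  refine add_le_add (H h hh1) ?_
  have hΩm : MeasurableSet (Ω ∩ {x | x + h ∈ Ω}) :=
    (hΩ.inter (hΩ.preimage (by fun_prop))).measurableSet
  have hle : ∀ᵐ x ∂(volume.restrict (Ω ∩ {x | x + h ∈ Ω})), ‖ph x * u x‖ ≤ (‖h‖ * η) * ‖u x‖ := by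
    filter_upwards [ae_restrict_mem hΩm] with x hx
    rw [norm_mul]
    gcongr
    exact H' h hh2 x hx.1
  refine (eLpNorm_le_mul_eLpNorm_of_ae_le_mul hle _).trans ?_
  rw [ENNReal.ofReal_mul (norm_nonneg _), ofReal_norm, ENNReal.ofReal_coe_nnreal, mul_assoc]
  gcongr
  refine le_trans ?_ hηε
  gcongr
  exact Measure.restrict_le_self

/-! ### Limits on the varying domains in a fixed direction -/

theorem tendsto_setLIntegral_inter_translate {N : ℕ} {Ω : Set (RN N)} (hΩ : IsOpen Ω)
    (w : RN N) {f : RN N → ℝ≥0∞} (hf : Measurable f) (hfi : ∫⁻ x in Ω, f x ≠ ∞) :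
    Tendsto (fun r : ℝ => ∫⁻ x in Ω ∩ {x | x + r • w ∈ Ω}, f x) (𝓝[>] 0)
      (𝓝 (∫⁻ x in Ω, f x)) := by
  have hm : ∀ r : ℝ, MeasurableSet {x | x + r • w ∈ Ω} := fun r =>
    (hΩ.preimage (by fun_prop)).measurableSet
  have e : ∀ r : ℝ, ∫⁻ x in Ω ∩ {x | x + r • w ∈ Ω}, f x =
      ∫⁻ x in Ω, {x | x + r • w ∈ Ω}.indicator f x := fun r => by
    rw [lintegral_indicator (hm r), Measure.restrict_restrict (hm r), Set.inter_comm]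
  simp only [e]
  refine tendsto_lintegral_filter_of_dominated_convergence f
    (Eventually.of_forall fun r => hf.indicator (hm r))
    (Eventually.of_forall fun r => ae_of_all _ fun x => Set.indicator_le_self _ _ _) hfi ?_
  filter_upwards [ae_restrict_mem hΩ.measurableSet] with x hx
  refine tendsto_const_nhds.congr' ?_
  have hc : Tendsto (fun r : ℝ => x + r • w) (𝓝[>] 0) (𝓝 x) := by
    have : Continuous fun r : ℝ => x + r • w := by fun_prop
    simpa using (this.tendsto 0).mono_left nhdsWithin_le_nhds
  filter_upwards [hc.eventually (hΩ.mem_nhds hx)] with r hr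
  exact (Set.indicator_of_mem (s := {x | x + r • w ∈ Ω}) hr f).symm

theorem ENNReal.tendsto_of_le_add_of_le_add {ι : Type*} {l : Filter ι} {a b e : ι → ℝ≥0∞}
    {c : ℝ≥0∞} (hb : Tendsto b l (𝓝 c)) (he : Tendsto e l (𝓝 0))
    (h1 : ∀ᶠ i in l, a i ≤ b i + e i) (h2 : ∀ᶠ i in l, b i ≤ a i + e i) :
    Tendsto a l (𝓝 c) := by
  have hl : Tendsto (fun i => b i - e i) l (𝓝 c) := by
    simpa using ENNReal.Tendsto.sub hb he (Or.inr ENNReal.zero_ne_top)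
  have hr : Tendsto (fun i => b i + e i) l (𝓝 c) := by simpa using hb.add he
  exact tendsto_of_tendsto_of_tendsto_of_le_of_le' hl hr
    (h2.mono fun i hi => tsub_le_iff_right.2 hi) h1

/-- Meant for `ℓ` the real or imaginary part. The triangle inequality compares the `L^p` norms of `ℓ
∘ T r` and `ℓ ∘ g` on the same moving domain; since `Ω` is open, those domains exhaust it by
dominated convergence. -/
theorem tendsto_lintegral_rpow_of_eLpNorm_sub {N : ℕ} {Ω : Set (RN N)} (hΩ : IsOpen Ω)
    {p : ℝ} (hp : 1 ≤ p) (w : RN N) {T : ℝ → RN N → ℂ} (hT : ∀ r, Measurable (T r))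
    {g : RN N → ℂ} (hgm : Measurable g) (hg : MemLp g (ENNReal.ofReal p) (volume.restrict Ω))
    (hlim : Tendsto (fun r => eLpNorm (fun x => T r x - g x) (ENNReal.ofReal p)
      (volume.restrict (Ω ∩ {x | x + r • w ∈ Ω}))) (𝓝[>] 0) (𝓝 0))
    (ℓ : ℂ →L[ℝ] ℝ) (hℓ : ∀ z, ‖ℓ z‖ ≤ ‖z‖) :
    Tendsto (fun r : ℝ => ∫⁻ x in Ω ∩ {x | x + r • w ∈ Ω}, ‖ℓ (T r x)‖ₑ ^ p) (𝓝[>] 0)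
      (𝓝 (∫⁻ x in Ω, ‖ℓ (g x)‖ₑ ^ p)) := by
  have hp0 : 0 < p := by linarith
  have hp1 : 1 ≤ ENNReal.ofReal p := by simpa using hp
  have hmT : ∀ r, Measurable fun x => ℓ (T r x) := fun r => ℓ.continuous.measurable.comp (hT r)
  have hmg : Measurable fun x => ℓ (g x) := ℓ.continuous.measurable.comp hgm
  have hgℓ : MemLp (fun x => ℓ (g x)) (ENNReal.ofReal p) (volume.restrict Ω) :=
    hg.of_le hmg.aestronglyMeasurable (ae_of_all _ fun x => hℓ _)
  have hfin : ∫⁻ x in Ω, ‖ℓ (g x)‖ₑ ^ p ≠ ∞ := by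
    rw [← eLpNorm_ofReal_rpow hp]
    exact ENNReal.rpow_ne_top_of_nonneg hp0.le hgℓ.eLpNorm_ne_top
  have h1 := tendsto_setLIntegral_inter_translate hΩ w (hmg.enorm.pow_const p) hfin
  simp only [← eLpNorm_ofReal_rpow hp] at h1 ⊢
  have h2 : Tendsto (fun r : ℝ => eLpNorm (fun x => ℓ (g x)) (ENNReal.ofReal p)
      (volume.restrict (Ω ∩ {x | x + r • w ∈ Ω}))) (𝓝[>] 0)
      (𝓝 (eLpNorm (fun x => ℓ (g x)) (ENNReal.ofReal p) (volume.restrict Ω))) := by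
    have := ((ENNReal.continuous_rpow_const (y := 1 / p)).tendsto _).comp h1
    simpa only [Function.comp_def, ← ENNReal.rpow_mul, mul_one_div_cancel hp0.ne',
      ENNReal.rpow_one] using this
  refine ((ENNReal.continuous_rpow_const (y := p)).tendsto _).comp ?_
  have hsub : ∀ r, eLpNorm (fun x => ℓ (T r x) - ℓ (g x)) (ENNReal.ofReal p)
      (volume.restrict (Ω ∩ {x | x + r • w ∈ Ω})) ≤ eLpNorm (fun x => T r x - g x)
      (ENNReal.ofReal p) (volume.restrict (Ω ∩ {x | x + r • w ∈ Ω})) := fun r =>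
    eLpNorm_mono fun x => by rw [← map_sub]; exact hℓ _
  refine ENNReal.tendsto_of_le_add_of_le_add h2 hlim (Eventually.of_forall fun r => ?_)
    (Eventually.of_forall fun r => ?_)
  · have := eLpNorm_add_le (μ := volume.restrict (Ω ∩ {x | x + r • w ∈ Ω}))
      hmg.aestronglyMeasurable ((hmT r).sub hmg).aestronglyMeasurable hp1
    rw [add_sub_cancel] at this
    exact this.trans (by gcongr; exact hsub r)
  · have := eLpNorm_sub_le (μ := volume.restrict (Ω ∩ {x | x + r • w ∈ Ω}))
      (hmT r).aestronglyMeasurable ((hmT r).sub hmg).aestronglyMeasurable hp1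
    rw [sub_sub_cancel] at this
    exact this.trans (by gcongr; exact hsub r)

/-! ### Energy of a single increment -/

theorem pNorm_rpow {p : ℝ} (hp : 1 ≤ p) (a : ℂ) : pNorm p a ^ p = |a.re| ^ p + |a.im| ^ p := by
  rw [pNorm, ← Real.rpow_mul (by positivity), one_div_mul_cancel (by linarith), Real.rpow_one]

theorem pNormVec_rpow {N : ℕ} {p : ℝ} (hp : 1 ≤ p) (z : CN N) :
    pNormVec p z ^ p = ‖(WithLp.toLp 2 (fun j => (z j).re) : RN N)‖ ^ p +
      ‖(WithLp.toLp 2 (fun j => (z j).im) : RN N)‖ ^ p := by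
  rw [pNormVec, ← Real.rpow_mul (by positivity), one_div_mul_cancel (by linarith), Real.rpow_one]

theorem enorm_rpow_eq_ofReal {F : Type*} [NormedAddCommGroup F] {p : ℝ} (hp : 0 ≤ p) (a : F) :
    ‖a‖ₑ ^ p = ENNReal.ofReal (‖a‖ ^ p) := by
  rw [← ofReal_norm, ENNReal.ofReal_rpow_of_nonneg (norm_nonneg _) hp]

theorem ofReal_pNorm_rpow_div {p : ℝ} (hp : 1 ≤ p) {r : ℝ} (hr : 0 < r) (a : ℂ) :
    ENNReal.ofReal (pNorm p a ^ p / r ^ p) =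
      ‖Complex.reCLM ((r⁻¹ : ℝ) * a)‖ₑ ^ p + ‖Complex.imCLM ((r⁻¹ : ℝ) * a)‖ₑ ^ p := by
  have hp0 : 0 ≤ p := by linarith
  rw [enorm_rpow_eq_ofReal hp0, enorm_rpow_eq_ofReal hp0,
    ← ENNReal.ofReal_add (by positivity) (by positivity), pNorm_rpow hp]
  congr 1
  simp only [Complex.reCLM_apply, Complex.imCLM_apply, Complex.re_ofReal_mul,
    Complex.im_ofReal_mul, norm_mul, Real.norm_eq_abs, abs_of_pos (inv_pos.2 hr)]
  rw [Real.mul_rpow (by positivity) (abs_nonneg _), Real.mul_rpow (by positivity) (abs_nonneg _),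
    Real.inv_rpow hr.le]
  field_simp

/-- The energy of the magnetic difference quotient of increment `h`. -/
noncomputable def translationEnergy {N : ℕ} (Ω : Set (RN N)) (A : RN N → RN N) (p : ℝ)
    (u : RN N → ℂ) (h : RN N) : ℝ≥0∞ :=
  ∫⁻ x in Ω ∩ {x | x + h ∈ Ω}, ENNReal.ofReal (pNorm p (magneticDiff A u (x + h) x) ^ p / ‖h‖ ^ p)

section

variable {N : ℕ} {Ω : Set (RN N)} {A : RN N → RN N} {u : RN N → ℂ} {p : ℝ}

theorem measurable_pNorm (p : ℝ) : Measurable (pNorm p) := by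
  unfold pNorm
  fun_prop

theorem measurable_ofReal_pNorm_magneticDiff (hA : Continuous A) (hum : Measurable u) :
    Measurable fun z : RN N × RN N =>
      ENNReal.ofReal (pNorm p (magneticDiff A u (z.2 + z.1) z.2) ^ p / ‖z.1‖ ^ p) := by
  have := (measurable_pNorm p).comp (measurable_magneticDiff hA hum)
  simp only [Function.comp_def] at this
  fun_prop

theorem translationEnergy_eq_lintegral_indicator (hΩ : IsOpen Ω) (h : RN N) :
    translationEnergy Ω A p u h = ∫⁻ x, {z : RN N × RN N | z.2 ∈ Ω ∧ z.2 + z.1 ∈ Ω}.indicator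
      (fun z => ENNReal.ofReal (pNorm p (magneticDiff A u (z.2 + z.1) z.2) ^ p / ‖z.1‖ ^ p))
      (h, x) := by
  have hm : MeasurableSet (Ω ∩ {x | x + h ∈ Ω}) :=
    (hΩ.inter (hΩ.preimage (by fun_prop))).measurableSet
  rw [translationEnergy, ← lintegral_indicator hm]
  rfl

theorem measurable_indicator_magneticDiff (hΩ : IsOpen Ω) (hA : Continuous A)
    (hum : Measurable u) :
    Measurable ({z : RN N × RN N | z.2 ∈ Ω ∧ z.2 + z.1 ∈ Ω}.indicator
      fun z => ENNReal.ofReal (pNorm p (magneticDiff A u (z.2 + z.1) z.2) ^ p / ‖z.1‖ ^ p)) :=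
  (measurable_ofReal_pNorm_magneticDiff hA hum).indicator
    ((hΩ.preimage continuous_snd).inter (hΩ.preimage (by fun_prop))).measurableSet

theorem measurable_translationEnergy (hΩ : IsOpen Ω) (hA : Continuous A) (hum : Measurable u) :
    Measurable (translationEnergy Ω A p u) := by
  simp only [funext (translationEnergy_eq_lintegral_indicator hΩ)]
  exact (measurable_indicator_magneticDiff hΩ hA hum).lintegral_prod_right'

theorem nonlocalEnergy_eq_lintegral_Ioi (hN : 1 ≤ N) (hΩ : IsOpen Ω) (hA : Continuous A)
    (hum : Measurable u) {ρ : ℝ → ℝ} (hρ : AEMeasurable ρ (volume.restrict (Set.Ioi 0))) :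
    nonlocalEnergy Ω A p u ρ = ∫⁻ r in Set.Ioi (0 : ℝ), ENNReal.ofReal (ρ r * r ^ (N - 1)) *
      ∫⁻ w : Metric.sphere (0 : RN N) 1, translationEnergy Ω A p u (r • (w : RN N))
        ∂(volume : Measure (RN N)).toSphere := by
  set Φ := ({z : RN N × RN N | z.2 ∈ Ω ∧ z.2 + z.1 ∈ Ω}.indicator
      fun z => ENNReal.ofReal (pNorm p (magneticDiff A u (z.2 + z.1) z.2) ^ p / ‖z.1‖ ^ p)) with hΦ
  have hΦm : Measurable Φ := measurable_indicator_magneticDiff hΩ hA hum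
  have hFm := measurable_translationEnergy (p := p) hΩ hA hum
  have hρn : AEMeasurable fun h : RN N => ENNReal.ofReal (ρ ‖h‖) := by
    refine ⟨fun h => ENNReal.ofReal (hρ.mk ρ ‖h‖),
      (hρ.measurable_mk.comp measurable_norm).ennreal_ofReal, ?_⟩
    filter_upwards [ae_norm_of_ae_Ioi hN hρ.ae_eq_mk] with h hh
    rw [hh]
  calc nonlocalEnergy Ω A p u ρ
      = ∫⁻ y, ∫⁻ h, Φ (h, y) * ENNReal.ofReal (ρ ‖h‖) := by
        rw [nonlocalEnergy, ← lintegral_indicator hΩ.measurableSet]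
        refine lintegral_congr fun y => ?_
        by_cases hy : y ∈ Ω
        · rw [Set.indicator_of_mem hy, ← lintegral_indicator hΩ.measurableSet,
            ← lintegral_add_left_eq_self _ y]
          refine lintegral_congr fun h => ?_
          by_cases hh : y + h ∈ Ω
          · rw [Set.indicator_of_mem hh, hΦ, Set.indicator_of_mem (by exact ⟨hy, hh⟩),
              add_sub_cancel_left, ENNReal.ofReal_mul]
            rw [pNorm]
            positivity
          · rw [Set.indicator_of_notMem hh, hΦ, Set.indicator_of_notMem (fun h => hh h.2), zero_mul]
        · simp [hΦ, hy]
    _ = ∫⁻ h, ∫⁻ y, Φ (h, y) * ENNReal.ofReal (ρ ‖h‖) := by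
        rw [lintegral_lintegral_swap]
        exact (hΦm.comp measurable_swap).aemeasurable.mul (hρn.comp_snd)
    _ = ∫⁻ h, translationEnergy Ω A p u h * ENNReal.ofReal (ρ ‖h‖) := by
        refine lintegral_congr fun h => ?_
        rw [lintegral_mul_const' _ _ ENNReal.ofReal_ne_top,
          translationEnergy_eq_lintegral_indicator hΩ]
    _ = _ := by
        rw [lintegral_eq_lintegral_Ioi_sphere hN
          (fun h => translationEnergy Ω A p u h * ENNReal.ofReal (ρ ‖h‖))
          (hFm.aemeasurable.mul hρn)]
        refine setLIntegral_congr_fun measurableSet_Ioi fun r hr => ?_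
        have hr0 : (0 : ℝ) < r := hr
        have hnorm : ∀ w : Metric.sphere (0 : RN N) 1, ‖r • (w : RN N)‖ = r := fun w => by
          simp [norm_smul, abs_of_pos hr0]
        simp only [hnorm]
        rw [lintegral_mul_const' _ _ ENNReal.ofReal_ne_top, mul_comm (ρ r),
          ENNReal.ofReal_mul (by positivity)]
        ring

theorem translationEnergy_smul (hA : Continuous A) (hum : Measurable u)
    (hp : 1 ≤ p) {r : ℝ} (hr : 0 < r) {w : RN N} (hw : ‖w‖ = 1) :
    translationEnergy Ω A p u (r • w) =
      (∫⁻ x in Ω ∩ {x | x + r • w ∈ Ω},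
        ‖Complex.reCLM ((r⁻¹ : ℝ) * magneticDiff A u (x + r • w) x)‖ₑ ^ p) +
      ∫⁻ x in Ω ∩ {x | x + r • w ∈ Ω},
        ‖Complex.imCLM ((r⁻¹ : ℝ) * magneticDiff A u (x + r • w) x)‖ₑ ^ p := by
  have hn : ‖r • w‖ = r := by rw [norm_smul, hw, mul_one, Real.norm_of_nonneg hr.le]
  have hm : Measurable fun x => magneticDiff A u (x + r • w) x :=
    (measurable_magneticDiff hA hum).comp (measurable_prodMk_left (x := r • w))
  simp only [translationEnergy, hn, ofReal_pNorm_rpow_div hp hr]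
  rw [lintegral_add_left]
  exact (Complex.reCLM.continuous.measurable.comp (by fun_prop)).enorm.pow_const p

/-- Used for domination as `r → 0` and for boundedness on `(δ, ∞)`. The factor `2` counts the real
and imaginary parts. -/
theorem translationEnergy_smul_le (hA : Continuous A) (hum : Measurable u)
    (hp : 1 ≤ p) {r : ℝ} (hr : 0 < r) {w : RN N} (hw : ‖w‖ = 1) {B : ℝ≥0∞}
    (hB : eLpNorm (fun x => magneticDiff A u (x + r • w) x) (ENNReal.ofReal p)
      (volume.restrict (Ω ∩ {x | x + r • w ∈ Ω})) ≤ ENNReal.ofReal r * B) :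
    translationEnergy Ω A p u (r • w) ≤ 2 * B ^ p := by
  have hp0 : 0 ≤ p := by linarith
  have key : ∀ ℓ : ℂ →L[ℝ] ℝ, (∀ z, ‖ℓ z‖ ≤ ‖z‖) →
      ∫⁻ x in Ω ∩ {x | x + r • w ∈ Ω},
        ‖ℓ ((r⁻¹ : ℝ) * magneticDiff A u (x + r • w) x)‖ₑ ^ p ≤ B ^ p := fun ℓ hℓ => by
    rw [← eLpNorm_ofReal_rpow hp]
    gcongr
    calc _ ≤ eLpNorm (fun x => (((r⁻¹ : ℝ) : ℂ) • fun x => magneticDiff A u (x + r • w) x) x)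
          (ENNReal.ofReal p) (volume.restrict (Ω ∩ {x | x + r • w ∈ Ω})) :=
          eLpNorm_mono fun x => hℓ _
      _ = ‖((r⁻¹ : ℝ) : ℂ)‖ₑ * eLpNorm (fun x => magneticDiff A u (x + r • w) x)
          (ENNReal.ofReal p) (volume.restrict (Ω ∩ {x | x + r • w ∈ Ω})) :=
          eLpNorm_const_smul _ _ _ _
      _ ≤ ‖((r⁻¹ : ℝ) : ℂ)‖ₑ * (ENNReal.ofReal r * B) := by gcongr
      _ = B := by
          rw [← mul_assoc, ← ofReal_norm, ← ENNReal.ofReal_mul (norm_nonneg _)]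
          simp [abs_of_pos hr, hr.ne']
  rw [translationEnergy_smul hA hum hp hr hw, two_mul]
  exact add_le_add (key _ fun z => by simpa using Complex.abs_re_le_norm z)
    (key _ fun z => by simpa using Complex.abs_im_le_norm z)

theorem eLpNorm_magneticDiff_le (hA : Continuous A) (hum : Measurable u) (hp : 1 ≤ p)
    (s : Set (RN N)) (h : RN N) :
    eLpNorm (fun x => magneticDiff A u (x + h) x) (ENNReal.ofReal p) (volume.restrict s) ≤
      2 * eLpNorm u (ENNReal.ofReal p) volume := by
  have hp1 : 1 ≤ ENNReal.ofReal p := by simpa using hp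
  have hAm := hA.measurable
  refine (eLpNorm_mono_measure _ Measure.restrict_le_self).trans ?_
  simp only [magneticDiff]
  refine (eLpNorm_sub_le (f := fun x => u (x + h)) (g := fun x => Complex.exp (Complex.I *
    ((inner ℝ (x + h - x) (A ((1 / 2 : ℝ) • (x + h + x))) : ℝ) : ℂ)) * u x)
    (Measurable.aestronglyMeasurable (by fun_prop))
    (Measurable.aestronglyMeasurable (by fun_prop)) hp1).trans ?_
  rw [two_mul]
  refine add_le_add (le_of_eq ?_) (eLpNorm_mono fun x => ?_)
  · exact eLpNorm_comp_measurePreserving hum.aestronglyMeasurable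
      (measurePreserving_add_right volume h)
  · rw [norm_mul, mul_comm Complex.I, Complex.norm_exp_ofReal_mul_I, one_mul]

end

/-! ### Averaging over directions and the limit for Borel data -/

theorem measurable_toLp_re {N : ℕ} {M : RN N → CN N} (hM : Measurable M) :
    Measurable fun x => (WithLp.toLp 2 (fun j => (M x j).re) : RN N) :=
  (WithLp.measurable_toLp 2 _).comp (measurable_pi_lambda _ fun j => by fun_prop)

theorem measurable_toLp_im {N : ℕ} {M : RN N → CN N} (hM : Measurable M) :
    Measurable fun x => (WithLp.toLp 2 (fun j => (M x j).im) : RN N) :=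
  (WithLp.measurable_toLp 2 _).comp (measurable_pi_lambda _ fun j => by fun_prop)

theorem lintegral_sphere_lintegral_abs_inner_rpow {N : ℕ} (hN : 1 ≤ N) {p : ℝ} (hp : 1 ≤ p)
    {ω : RN N} (hω : ‖ω‖ = 1) (μ : Measure (RN N)) [SFinite μ] {V : RN N → RN N}
    (hV : Measurable V) :
    ∫⁻ w : Metric.sphere (0 : RN N) 1, (∫⁻ x, ENNReal.ofReal (|inner ℝ (V x) (w : RN N)| ^ p) ∂μ)
        ∂(volume : Measure (RN N)).toSphere =
      ENNReal.ofReal (p * sphereConst p ω) * ∫⁻ x, ENNReal.ofReal (‖V x‖ ^ p) ∂μ := by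
  rw [lintegral_lintegral_swap, ← lintegral_const_mul' _ _ ENNReal.ofReal_ne_top]
  · exact lintegral_congr fun x => lintegral_sphere_abs_inner_rpow hN hp hω (V x)
  · exact Measurable.aemeasurable (by fun_prop)

theorem lintegral_sphere_energy {N : ℕ} (hN : 1 ≤ N) {p : ℝ} (hp : 1 ≤ p)
    {ω : RN N} (hω : ‖ω‖ = 1) (μ : Measure (RN N)) [SFinite μ] {M : RN N → CN N}
    (hM : Measurable M) :
    ∫⁻ w : Metric.sphere (0 : RN N) 1,
      ((∫⁻ x, ‖Complex.reCLM (contraction (w : RN N) (M x))‖ₑ ^ p ∂μ) +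
        ∫⁻ x, ‖Complex.imCLM (contraction (w : RN N) (M x))‖ₑ ^ p ∂μ)
        ∂(volume : Measure (RN N)).toSphere =
      ENNReal.ofReal (p * sphereConst p ω) * ∫⁻ x, ENNReal.ofReal (pNormVec p (M x) ^ p) ∂μ := by
  have hp0 : 0 ≤ p := by linarith
  have hre := measurable_toLp_re hM
  have him := measurable_toLp_im hM
  simp only [Complex.reCLM_apply, Complex.imCLM_apply, re_contraction, im_contraction,
    enorm_rpow_eq_ofReal hp0, Real.norm_eq_abs, pNormVec_rpow hp]
  rw [lintegral_add_left, lintegral_sphere_lintegral_abs_inner_rpow hN hp hω μ hre,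
    lintegral_sphere_lintegral_abs_inner_rpow hN hp hω μ him, ← mul_add, ← lintegral_add_left]
  · congr 1
    refine lintegral_congr fun x => ?_
    rw [← ENNReal.ofReal_add (by positivity) (by positivity)]
  · fun_prop
  · refine Measurable.lintegral_prod_right' (f := fun z : Metric.sphere (0 : RN N) 1 × RN N =>
      ENNReal.ofReal (|inner ℝ (WithLp.toLp 2 (fun j => (M z.2 j).re) : RN N) (z.1 : RN N)| ^ p)) ?_
    have : Measurable fun z : Metric.sphere (0 : RN N) 1 × RN N =>
        (WithLp.toLp 2 (fun j => (M z.2 j).re) : RN N) := hre.comp measurable_snd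
    fun_prop

theorem IsWeakGradient.tendsto_nonlocalEnergy_of_measurable {N : ℕ} (hN : 1 ≤ N)
    {Ω : Set (RN N)} (hΩ : IsOpen Ω) (hΩb : Bornology.IsBounded Ω) (hΩl : HasLipschitzBoundary Ω)
    {u : RN N → ℂ} {G : RN N → CN N} {A : RN N → RN N} (hA : Continuous A)
    (hw : IsWeakGradient Ω u G) (hu : Integrable u) (hum : Measurable u)
    (hG : Integrable G) (hGm : Measurable G) (hu0 : ∀ x ∉ Ω, u x = 0) (hG0 : ∀ x ∉ Ω, G x = 0)
    {p : ℝ} (hp : 1 ≤ p) (hup : MemLp u (ENNReal.ofReal p) volume)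
    (hGp : MemLp G (ENNReal.ofReal p) volume)
    (hMp : MemLp (magneticGradient A u G) (ENNReal.ofReal p) (volume.restrict Ω))
    {ρ : ℕ → ℝ → ℝ} (hρ : IsRadialMollifierSeq N ρ) {ω : RN N} (hω : ‖ω‖ = 1) :
    Tendsto (fun m => nonlocalEnergy Ω A p u (ρ m)) atTop
      (𝓝 (ENNReal.ofReal (p * sphereConst p ω) * magneticEnergy Ω A p u G)) := by
  have : NeZero N := ⟨by omega⟩
  have hp0 : 0 ≤ p := by linarith
  have hp1 : 1 ≤ ENNReal.ofReal p := by simpa using hp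
  set M := magneticGradient A u G with hM
  have hMm : Measurable M := measurable_magneticGradient hA hum hGm
  have hcM : ∀ w : RN N, Measurable fun x => contraction w (M x) := fun w =>
    (contraction w).continuous.measurable.comp hMm
  have hTm : ∀ h : RN N, Measurable fun x => magneticDiff A u (x + h) x := fun h =>
    (measurable_magneticDiff hA hum).comp (measurable_prodMk_left (x := h))
  have hFm := measurable_translationEnergy (p := p) hΩ hA hum
  have happrox := fun (ε : ℝ≥0∞) (hε : 0 < ε) =>
    hw.exists_forall_eLpNorm_magneticDiff_sub_le hΩ hΩb hΩl hA hu hum hG hGm hu0 hG0 hp hup hGp hε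
  have hnw : ∀ {r : ℝ}, 0 < r → ∀ {w : RN N}, ‖w‖ = 1 → ‖r • w‖ = r := fun hr w hw1 => by
    rw [norm_smul, hw1, mul_one, Real.norm_of_nonneg hr.le]
  have henw : ∀ {r : ℝ}, 0 < r → ∀ {w : RN N}, ‖w‖ = 1 → ‖r • w‖ₑ = ENNReal.ofReal r :=
    fun hr w hw1 => by rw [← ofReal_norm, hnw hr hw1]
  have hcMp : ∀ w : RN N, ‖w‖ = 1 →
      MemLp (fun x => contraction w (M x)) (ENNReal.ofReal p) (volume.restrict Ω) := fun w hw1 =>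
    hMp.of_le (hcM w).aestronglyMeasurable (ae_of_all _ fun x => by
      simpa [hw1] using norm_contraction_apply_le w (M x))
  simp only [nonlocalEnergy_eq_lintegral_Ioi hN hΩ hA hum (hρ.aemeasurable _)]
  refine tendsto_lintegral_mul_of_concentrating hρ.tendsto_one hρ.tendsto_zero ?_ ?_
  · rw [magneticEnergy, ← hM, ← lintegral_sphere_energy hN hp hω (volume.restrict Ω) hMm]
    -- Tolerance `1` suffices for domination: the quotients then have `L^p` norm at most `‖M‖_p +
    -- 1`, uniformly in the direction, and the sphere has finite measure.
    obtain ⟨δ, hδ, hδ1⟩ := happrox 1 one_pos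
    set B := eLpNorm M (ENNReal.ofReal p) (volume.restrict Ω) + 1 with hB
    have hBt : B ≠ ∞ := by simpa [hB] using hMp.eLpNorm_ne_top
    refine tendsto_lintegral_filter_of_dominated_convergence (fun _ => 2 * B ^ p)
      (Eventually.of_forall fun r => hFm.comp (by fun_prop)) ?_ ?_ ?_
    · filter_upwards [Ioo_mem_nhdsGT hδ] with r hr
      refine ae_of_all _ fun w => ?_
      have hw1 : ‖(w : RN N)‖ = 1 := by simp
      refine translationEnergy_smul_le hA hum hp hr.1 hw1 ?_
      have h1 := hδ1 (r • (w : RN N)) (by rw [hnw hr.1 hw1]; exact hr.2)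
      rw [henw hr.1 hw1, mul_one] at h1
      have h2 := eLpNorm_add_le (μ := volume.restrict (Ω ∩ {x | x + r • (w : RN N) ∈ Ω}))
        (hcM (r • (w : RN N))).aestronglyMeasurable
        ((hTm (r • (w : RN N))).sub (hcM (r • (w : RN N)))).aestronglyMeasurable hp1
      rw [add_sub_cancel] at h2
      refine h2.trans ?_
      rw [hB, mul_add, mul_one]
      refine add_le_add ?_ h1
      refine (eLpNorm_mono_measure _ (Measure.restrict_mono Set.inter_subset_left le_rfl)).trans ?_
      refine eLpNorm_le_mul_eLpNorm_of_ae_le_mul (ae_of_all _ fun x => ?_) _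
      simpa [hnw hr.1 hw1] using norm_contraction_apply_le (r • (w : RN N)) (M x)
    · rw [lintegral_const]
      exact ENNReal.mul_ne_top (ENNReal.mul_ne_top (by simp)
        (ENNReal.rpow_ne_top_of_nonneg hp0 hBt)) (measure_ne_top _ _)
    · refine ae_of_all _ fun w => ?_
      have hw1 : ‖(w : RN N)‖ = 1 := by simp
      have hlim : Tendsto (fun r : ℝ => eLpNorm (fun x => ((r⁻¹ : ℝ) : ℂ) *
          magneticDiff A u (x + r • (w : RN N)) x - contraction (w : RN N) (M x))
          (ENNReal.ofReal p) (volume.restrict (Ω ∩ {x | x + r • (w : RN N) ∈ Ω})))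
          (𝓝[>] 0) (𝓝 0) := by
        refine ENNReal.tendsto_nhds_zero.2 fun ε hε => ?_
        obtain ⟨η, hη, hη1⟩ := happrox ε hε
        filter_upwards [Ioo_mem_nhdsGT hη] with r hr
        have h1 := hη1 (r • (w : RN N)) (by rw [hnw hr.1 hw1]; exact hr.2)
        rw [henw hr.1 hw1] at h1
        have hr0 : (r : ℂ) ≠ 0 := by exact_mod_cast hr.1.ne'
        have e : (fun x => ((r⁻¹ : ℝ) : ℂ) * magneticDiff A u (x + r • (w : RN N)) x -
            contraction (w : RN N) (M x)) = ((r⁻¹ : ℝ) : ℂ) • fun x =>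
              magneticDiff A u (x + r • (w : RN N)) x - contraction (r • (w : RN N)) (M x) := by
          ext x
          simp only [Pi.smul_apply, smul_eq_mul, contraction_smul]
          push_cast
          field_simp
        rw [e, eLpNorm_const_smul]
        calc _ ≤ ‖((r⁻¹ : ℝ) : ℂ)‖ₑ * (ENNReal.ofReal r * ε) := by gcongr
          _ = ε := by
            rw [← mul_assoc, ← ofReal_norm, ← ENNReal.ofReal_mul (norm_nonneg _)]
            simp [abs_of_pos hr.1, hr.1.ne']
      have hm : ∀ r : ℝ, Measurable fun x => ((r⁻¹ : ℝ) : ℂ) *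
          magneticDiff A u (x + r • (w : RN N)) x := fun r => (hTm _).const_mul _
      have hre := tendsto_lintegral_rpow_of_eLpNorm_sub hΩ hp w hm (hcM w) (hcMp w hw1) hlim
        Complex.reCLM fun z => by simpa using Complex.abs_re_le_norm z
      have him := tendsto_lintegral_rpow_of_eLpNorm_sub hΩ hp w hm (hcM w) (hcMp w hw1) hlim
        Complex.imCLM fun z => by simpa using Complex.abs_im_le_norm z
      refine (hre.add him).congr' ?_
      filter_upwards [self_mem_nhdsWithin] with r hr
      exact (translationEnergy_smul hA hum hp hr hw1).symm
  · intro δ hδ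
    -- For `r > δ` no smoothness is needed: the phase is unimodular, so the difference has norm at
    -- most `2‖u‖_p`.
    set B := ENNReal.ofReal δ⁻¹ * (2 * eLpNorm u (ENNReal.ofReal p) volume) with hB
    have hBt : B ≠ ∞ := ENNReal.mul_ne_top ENNReal.ofReal_ne_top
      (ENNReal.mul_ne_top (by simp) hup.eLpNorm_ne_top)
    refine ⟨∫⁻ _w : Metric.sphere (0 : RN N) 1, 2 * B ^ p
      ∂(volume : Measure (RN N)).toSphere, ?_, fun r hr => ?_⟩
    · rw [lintegral_const]
      exact ENNReal.mul_ne_top (ENNReal.mul_ne_top (by simp)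
        (ENNReal.rpow_ne_top_of_nonneg hp0 hBt)) (measure_ne_top _ _)
    · refine lintegral_mono fun w => ?_
      have hr0 : 0 < r := hδ.trans hr
      refine translationEnergy_smul_le hA hum hp hr0 (by simp) ?_
      refine (eLpNorm_magneticDiff_le hA hum hp _ _).trans ?_
      rw [hB, ← mul_assoc, ← ENNReal.ofReal_mul hr0.le]
      refine le_mul_of_one_le_left zero_le ?_
      rw [ENNReal.one_le_ofReal, ← div_eq_mul_inv, one_le_div hδ]
      exact hr.le

/-! ### Uniqueness of weak gradients and choice of representatives -/

/-- Lets an arbitrary weak gradient inherit the finite energy of the one supplied by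
`MemMagneticSobolev`. -/
theorem IsWeakGradient.ae_eq {N : ℕ} {Ω : Set (RN N)} (hΩ : IsOpen Ω) {u : RN N → ℂ}
    {G G' : RN N → CN N} (h : IsWeakGradient Ω u G) (h' : IsWeakGradient Ω u G') :
    G =ᵐ[volume.restrict Ω] G' := by
  have key := hΩ.ae_eq_zero_of_integral_contDiff_smul_eq_zero (f := fun x => G x - G' x)
    (h.locallyIntegrableOn_grad.sub h'.locallyIntegrableOn_grad) ?_
  · filter_upwards [(ae_restrict_iff' hΩ.measurableSet).2 key] with x hx
    exact sub_eq_zero.1 hx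
  intro φ hφ hc hs
  have hint : ∀ {H : RN N → CN N}, LocallyIntegrableOn H Ω →
      Integrable fun x => φ x • H x := fun {H} hH => by
    obtain ⟨C, hC⟩ := hc.exists_bound_of_continuous hφ.continuous
    have h1 : IntegrableOn (fun x => φ x • H x) (tsupport φ) :=
      (hH.integrableOn_compact_subset hs hc).bdd_smul C
        hφ.continuous.aestronglyMeasurable (ae_of_all _ hC)
    refine (integrableOn_iff_integrable_of_support_subset fun x hx => ?_).1 h1
    exact subset_tsupport φ (Function.mem_support.2 fun h0 => hx (by simp [h0]))
  have hI := hint h.locallyIntegrableOn_grad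
  have hI' := hint h'.locallyIntegrableOn_grad
  have hset : ∀ H : RN N → CN N, ∀ j,
      ∫ x in Ω, ((φ x : ℝ) : ℂ) * H x j = ∫ x, ((φ x : ℝ) : ℂ) * H x j := fun H j => by
    refine setIntegral_eq_integral_of_forall_compl_eq_zero fun x hx => ?_
    rw [image_eq_zero_of_notMem_tsupport fun hx' => hx (hs hx')]
    simp
  simp only [smul_sub]
  rw [integral_sub hI hI', sub_eq_zero]
  ext j
  have e : ∀ {H : RN N → CN N}, Integrable (fun x => φ x • H x) →
      (∫ x, φ x • H x) j = ∫ x in Ω, ((φ x : ℝ) : ℂ) * H x j := fun {H} hH => by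
    rw [hset]
    have := (EuclideanSpace.proj (𝕜 := ℂ) j).integral_comp_comm hH
    simpa using this.symm
  rw [e hI, e hI', ← neg_inj, ← h.integral_eq φ hφ hc hs j, ← h'.integral_eq φ hφ hc hs j]

theorem magneticEnergy_congr {N : ℕ} {Ω : Set (RN N)} {A : RN N → RN N} {p : ℝ}
    {u u' : RN N → ℂ} {G G' : RN N → CN N} (hu : u =ᵐ[volume.restrict Ω] u')
    (hG : G =ᵐ[volume.restrict Ω] G') :
    magneticEnergy Ω A p u G = magneticEnergy Ω A p u' G' := by
  refine lintegral_congr_ae ?_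
  filter_upwards [hu, hG] with x hx hx'
  simp only [magneticGradient, hx, hx']

theorem nonlocalEnergy_congr {N : ℕ} {Ω : Set (RN N)} {A : RN N → RN N} {p : ℝ}
    {u u' : RN N → ℂ} {ρ : ℝ → ℝ} (hu : u =ᵐ[volume.restrict Ω] u') :
    nonlocalEnergy Ω A p u ρ = nonlocalEnergy Ω A p u' ρ := by
  refine lintegral_congr_ae ?_
  filter_upwards [hu] with y hy
  refine lintegral_congr_ae ?_
  filter_upwards [hu] with x hx
  simp only [magneticDiff, hx, hy]

theorem IsWeakGradient.congr {N : ℕ} {Ω : Set (RN N)} {u u' : RN N → ℂ} {G G' : RN N → CN N}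
    (h : IsWeakGradient Ω u G) (hu : u =ᵐ[volume.restrict Ω] u')
    (hG : G =ᵐ[volume.restrict Ω] G') (hu' : LocallyIntegrableOn u' Ω)
    (hG' : LocallyIntegrableOn G' Ω) : IsWeakGradient Ω u' G' := by
  refine ⟨hu', hG', fun φ hφ hc hs j => ?_⟩
  have e1 : ∫ x in Ω, ((fderiv ℝ φ x (EuclideanSpace.single j 1) : ℝ) : ℂ) * u' x =
      ∫ x in Ω, ((fderiv ℝ φ x (EuclideanSpace.single j 1) : ℝ) : ℂ) * u x := by
    refine integral_congr_ae ?_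
    filter_upwards [hu] with x hx
    rw [hx]
  have e2 : ∫ x in Ω, ((φ x : ℝ) : ℂ) * G' x j = ∫ x in Ω, ((φ x : ℝ) : ℂ) * G x j := by
    refine integral_congr_ae ?_
    filter_upwards [hG] with x hx
    rw [hx]
  rw [e1, e2, h.integral_eq φ hφ hc hs j]

theorem memLp_of_lintegral_pNormVec_lt_top {N : ℕ} {μ : Measure (RN N)} {p : ℝ} (hp : 1 ≤ p)
    {M : RN N → CN N} (hM : AEStronglyMeasurable M μ)
    (h : ∫⁻ x, ENNReal.ofReal (pNormVec p (M x) ^ p) ∂μ < ∞) :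
    MemLp M (ENNReal.ofReal p) μ := by
  have hp0 : 0 < p := by linarith
  have hcre : Continuous fun z : CN N => (WithLp.toLp 2 (fun j => (z j).re) : RN N) := by fun_prop
  have hcim : Continuous fun z : CN N => (WithLp.toLp 2 (fun j => (z j).im) : RN N) := by fun_prop
  have key : ∀ {V : RN N → RN N}, AEStronglyMeasurable V μ →
      (∀ x, ‖V x‖ ^ p ≤ pNormVec p (M x) ^ p) → MemLp V (ENNReal.ofReal p) μ := fun {V} hV hle => by
    refine ⟨hV, ?_⟩
    rw [eLpNorm_ofReal_eq hp]
    refine ENNReal.rpow_lt_top_of_nonneg (by positivity) (ne_of_lt (lt_of_le_of_lt ?_ h))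
    refine lintegral_mono fun x => ?_
    rw [enorm_rpow_eq_ofReal hp0.le]
    exact ENNReal.ofReal_le_ofReal (hle x)
  have h1 := key (hcre.comp_aestronglyMeasurable hM) fun x => by
    rw [pNormVec_rpow hp]; exact le_add_of_nonneg_right (by positivity)
  have h2 := key (hcim.comp_aestronglyMeasurable hM) fun x => by
    rw [pNormVec_rpow hp]; exact le_add_of_nonneg_left (by positivity)
  refine (h1.norm.add h2.norm).mono' hM (ae_of_all _ fun x => ?_)
  have e : M x = WithLp.toLp 2 (fun j => ((M x j).re : ℂ)) +
      Complex.I • WithLp.toLp 2 (fun j => ((M x j).im : ℂ)) := by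
    ext j
    simp [mul_comm Complex.I, Complex.re_add_im]
  have e2 : ∀ V : RN N, ‖(WithLp.toLp 2 (fun j => (V j : ℂ)) : CN N)‖ = ‖V‖ := fun V => by
    simp [EuclideanSpace.norm_eq]
  conv_lhs => rw [e]
  refine (norm_add_le _ _).trans (le_of_eq ?_)
  rw [norm_smul, Complex.norm_I, one_mul]
  exact congrArg₂ _ (e2 (WithLp.toLp 2 fun j => (M x j).re))
    (e2 (WithLp.toLp 2 fun j => (M x j).im))

theorem mainTheorem3 (N : ℕ) (hN : 1 ≤ N) (Ω : Set (RN N)) (hΩ_open : IsOpen Ω)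
    (hΩ_bdd : Bornology.IsBounded Ω) (hΩ_lip : HasLipschitzBoundary Ω)
    (A : RN N → RN N) (hA : ContDiff ℝ 2 A) (p : ℝ) (hp : 1 ≤ p)
    (u : RN N → ℂ) (hu : MemMagneticSobolev Ω A p u)
    (ρ : ℕ → ℝ → ℝ) (hρ : IsRadialMollifierSeq N ρ)
    (ω : RN N) (hω : ‖ω‖ = 1)
    (G : RN N → CN N) (hG : IsWeakGradient Ω u G) :
    magneticEnergy Ω A p u G < ∞ ∧
      Tendsto (fun m => nonlocalEnergy Ω A p u (ρ m)) atTop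
        (𝓝 (ENNReal.ofReal (p * sphereConst p ω) * magneticEnergy Ω A p u G)) := by
  obtain ⟨hup, G₁, hG₁, hE₁⟩ := hu
  have hAc : Continuous A := hA.continuous
  have hp1 : 1 ≤ ENNReal.ofReal p := by simpa using hp
  have hΩm := hΩ_open.measurableSet
  have hE : magneticEnergy Ω A p u G < ∞ := by
    rwa [magneticEnergy_congr (EventuallyEq.refl _ u) (hG.ae_eq hΩ_open hG₁)]
  refine ⟨hE, ?_⟩
  have : IsFiniteMeasure (volume.restrict Ω) :=
    isFiniteMeasure_restrict.2 hΩ_bdd.measure_lt_top.ne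
  have hGs : AEStronglyMeasurable G (volume.restrict Ω) :=
    hG.locallyIntegrableOn_grad.aestronglyMeasurable
  have hus := hup.aestronglyMeasurable
  -- Borel representatives vanishing off `Ω`; the energies and the weak gradient identity see only
  -- the classes on `Ω`.
  set u' : RN N → ℂ := Ω.indicator (hus.mk u) with hu'
  set G' : RN N → CN N := Ω.indicator (hGs.mk G) with hG'
  have huu' : u =ᵐ[volume.restrict Ω] u' := by
    filter_upwards [hus.ae_eq_mk, ae_restrict_mem hΩm] with x hx hxΩ
    rw [hu', Set.indicator_of_mem hxΩ, hx]
  have hGG' : G =ᵐ[volume.restrict Ω] G' := by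
    filter_upwards [hGs.ae_eq_mk, ae_restrict_mem hΩm] with x hx hxΩ
    rw [hG', Set.indicator_of_mem hxΩ, hx]
  have hum : Measurable u' := hus.measurable_mk.indicator hΩm
  have hGm : Measurable G' := hGs.measurable_mk.indicator hΩm
  have hE' : magneticEnergy Ω A p u' G' < ∞ := by rwa [← magneticEnergy_congr huu' hGG']
  have hMp : MemLp (magneticGradient A u' G') (ENNReal.ofReal p) (volume.restrict Ω) :=
    memLp_of_lintegral_pNormVec_lt_top hp
      (measurable_magneticGradient hAc hum hGm).aestronglyMeasurable hE'
  have hup' : MemLp u' (ENNReal.ofReal p) (volume.restrict Ω) := hup.ae_eq huu'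
  -- On bounded `Ω` the field `A` is bounded, so `iAu` is in `L^p` and can be added back to the
  -- magnetic gradient.
  have hGp' : MemLp G' (ENNReal.ofReal p) (volume.restrict Ω) := by
    obtain ⟨C, hC⟩ := hΩ_bdd.isCompact_closure.exists_bound_of_continuousOn hAc.continuousOn
    refine (hMp.norm.add (hup'.norm.const_mul C)).mono' hGm.aestronglyMeasurable ?_
    filter_upwards [ae_restrict_mem hΩm] with x hx
    have e : G' x = magneticGradient A u' G' x +
        (Complex.I * u' x) • WithLp.toLp 2 (fun j => ((A x j : ℝ) : ℂ)) := by
      ext j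
      simp [magneticGradient]
      ring
    conv_lhs => rw [e]
    refine (norm_add_le _ _).trans ?_
    have e2 : ‖(WithLp.toLp 2 (fun j => ((A x j : ℝ) : ℂ)) : CN N)‖ = ‖A x‖ := by
      simp [EuclideanSpace.norm_eq]
    rw [norm_smul, norm_mul, Complex.norm_I, one_mul, e2, mul_comm]
    simp only [Pi.add_apply]
    gcongr
    exact hC x (subset_closure hx)
  have huΩ : Ω.indicator u' = u' := by simp [hu']
  have hGΩ : Ω.indicator G' = G' := by simp [hG']
  have hupV : MemLp u' (ENNReal.ofReal p) volume := by
    rwa [← huΩ, memLp_indicator_iff_restrict hΩm]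
  have hGpV : MemLp G' (ENNReal.ofReal p) volume := by
    rwa [← hGΩ, memLp_indicator_iff_restrict hΩm]
  have huI : Integrable u' := by
    rw [← huΩ, integrable_indicator_iff hΩm]; exact hup'.integrable hp1
  have hGI : Integrable G' := by
    rw [← hGΩ, integrable_indicator_iff hΩm]; exact hGp'.integrable hp1
  have hw : IsWeakGradient Ω u' G' := hG.congr huu' hGG'
    (huI.locallyIntegrable.locallyIntegrableOn _) (hGI.locallyIntegrable.locallyIntegrableOn _)
  have key := hw.tendsto_nonlocalEnergy_of_measurable hN hΩ_open hΩ_bdd hΩ_lip hAc huI hum hGI hGm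
    (fun x hx => Set.indicator_of_notMem hx _) (fun x hx => Set.indicator_of_notMem hx _)
    hp hupV hGpV hMp hρ hω
  rw [magneticEnergy_congr huu' hGG']
  exact key.congr fun m => (nonlocalEnergy_congr huu').symm
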